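/- Let $X$ be a Banach space, let $\{T(t)\}_{t\ge 0}$ be a $C_0$-semigroup of bounded linear operators on $X$, let $-\infty<a<b<\infty$, $\frac12<\alpha\le 1$, $0\le\beta\le 1$ and $\gamma=\alpha+\beta(1-\alpha)$. Let $\psi\in C^1([a,b],\mathbb R)$ be increasing with $\psi'(t)\ne 0$ for all $t\in[a,b]$. For $0<\alpha<1$ let $$M_\alpha(\theta)=\sum_{n=0}^\infty\frac{(-\theta)^n}{n!\,\Gamma(1-\alpha(n+1))}$$ be the Wright function (with $1/\Gamma=0$ at the poles of $\Gamma$), and for $t>0$, $x\in X$ put $$P_\alpha(t)x=\int_0^\infty\alpha\theta M_\alpha(\theta)\,T(t^\alpha\theta)x\,d\theta\quad(\alpha<1),\qquad P_1(t)x=T(t)x,\qquad K_\alpha(t)=t^{\alpha-1}P_\alpha(t)$$ (for $\alpha=1$, $M_1$ is understood as the Dirac mass at $\theta=1$). Let $C^{1-\gamma;\psi}([a,b],X)$ be the space of all continuous $q:(a,b]\to X$ for which $t\mapsto(\psi(t)-\psi(a))^{1-\gamma}q(t)$ extends to a continuous function on $[a,b]$, with the norm $\|q\|=\sup_{t\in(a,b]}\|(\psi(t)-\psi(a))^{1-\gamma}q(t)\|$.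 Suppose that the operator $P_\alpha(t)$ is compact for every $t>0$. Then for every $f\in L^2([a,b],X)$ and every $t\in(a,b]$ the function $s\mapsto\psi'(s)K_\alpha(\psi(t)-\psi(s))f(s)$ is Bochner integrable on $(a,t)$, and $$(\Lambda f)(t)=\int_a^t\psi'(s)K_\alpha(\psi(t)-\psi(s))f(s)\,ds,\qquad t\in(a,b],$$ defines a bounded linear operator $\Lambda:L^2([a,b],X)\to C^{1-\gamma;\psi}([a,b],X)$ which is compact. -/

import Mathlib

open Set MeasureTheory Filter Topology

noncomputable section

namespace PsiHilfer

/-- `T`, restricted to `[0, ∞)`, is a strongly continuous semigroup (a `C₀`-semigroup) of bounded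
linear operators on `X`. The values `T t` with `t < 0` are irrelevant. -/
structure IsC0Semigroup {X : Type*} [NormedAddCommGroup X] [NormedSpace ℝ X]
    (T : ℝ → X →L[ℝ] X) : Prop where
  map_zero : T 0 = ContinuousLinearMap.id ℝ X
  map_add : ∀ s t : ℝ, 0 ≤ s → 0 ≤ t → T (s + t) = (T s).comp (T t)
  strong_continuity : ∀ x : X, Tendsto (fun t : ℝ => T t x) (𝓝[>] 0) (𝓝 x)

/-- The Wright function
`M_α(θ) = ∑_{n ≥ 0} (-θ)ⁿ / (n! Γ(1 - α (n + 1)))`, for `0 < α < 1`.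
Here `1 / Γ` vanishes at the poles of `Γ`, in agreement with the conventions `Real.Gamma (-m) = 0`
for natural numbers `m` and `x / 0 = 0`. -/
def wrightM (α θ : ℝ) : ℝ :=
  ∑' n : ℕ, (-θ) ^ n / ((n.factorial : ℝ) * Real.Gamma (1 - α * ((n : ℝ) + 1)))

/-- The operator `P_α(t) x = ∫₀^∞ α θ M_α(θ) T(t^α θ) x dθ` for `0 < α < 1`. For `α = 1` the
function `M_α` degenerates to the Dirac mass at `θ = 1`, so that `P_1(t) = T(t)`. -/
def opP {X : Type*} [NormedAddCommGroup X] [NormedSpace ℝ X]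
    (α : ℝ) (T : ℝ → X →L[ℝ] X) (t : ℝ) (x : X) : X :=
  if α = 1 then T t x
  else ∫ θ in Ioi (0 : ℝ), (α * θ * wrightM α θ) • T (t ^ α * θ) x

/-- The operator `K_α(t) = t^(α-1) P_α(t)`. -/
def opK {X : Type*} [NormedAddCommGroup X] [NormedSpace ℝ X]
    (α : ℝ) (T : ℝ → X →L[ℝ] X) (t : ℝ) (x : X) : X :=
  t ^ (α - 1) • opP α T t x

/-- The admissible functions `ψ`: real valued, `C¹` on `[a, b]`, increasing, and with nowhere
vanishing derivative on `[a, b]` (one-sided at the end points). -/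
structure TimeChange (a b : ℝ) where
  /-- the underlying function; only its values on `[a, b]` matter -/
  toFun : ℝ → ℝ
  contDiffOn : ContDiffOn ℝ 1 toFun (Icc a b)
  strictMonoOn : StrictMonoOn toFun (Icc a b)
  deriv_ne_zero : ∀ t ∈ Icc a b, derivWithin toFun (Icc a b) t ≠ 0

instance {a b : ℝ} : CoeFun (TimeChange a b) (fun _ => ℝ → ℝ) := ⟨TimeChange.toFun⟩

/-- The derivative `ψ'` on `[a, b]`. -/
def TimeChange.deriv {a b : ℝ} (ψ : TimeChange a b) (s : ℝ) : ℝ :=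
  derivWithin ψ (Icc a b) s

/-- The functions `q : (a, b] → X` that belong to `C^{r;ψ}([a, b], X)`: `q` is continuous on
`(a, b]`, and `t ↦ (ψ(t) - ψ(a))^r q(t)` extends to a continuous function on `[a, b]`. -/
def weightedSubmodule {a b : ℝ} (r : ℝ) (ψ : TimeChange a b) (X : Type*)
    [NormedAddCommGroup X] [NormedSpace ℝ X] : Submodule ℝ (Ioc a b → X) where
  carrier := {q | Continuous q ∧
    ∃ g : C(Icc a b, X), ∀ t : Ioc a b,
      g ⟨t, Ioc_subset_Icc_self t.2⟩ = (ψ t - ψ a) ^ r • q t}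
  zero_mem' := ⟨continuous_const, 0, fun t => by simp⟩
  add_mem' := by
    rintro p q ⟨hp, g, hg⟩ ⟨hq, h, hh⟩
    exact ⟨hp.add hq, g + h, fun t => by simp [hg, hh]⟩
  smul_mem' := by
    rintro c q ⟨hq, h, hh⟩
    exact ⟨hq.const_smul c, c • h, fun t => by simp [hh, smul_comm c]⟩

/-- The weighted space `C^{r;ψ}([a, b], X)`; its norm is
`‖q‖ = sup_{t ∈ (a, b]} ‖(ψ(t) - ψ(a))^r q(t)‖`, the supremum norm over `[a, b]` of the continuous
extension of `t ↦ (ψ(t) - ψ(a))^r q(t)`. -/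
def WeightedC {a b : ℝ} (r : ℝ) (ψ : TimeChange a b) (X : Type*)
    [NormedAddCommGroup X] [NormedSpace ℝ X] : Type _ :=
  weightedSubmodule r ψ X

namespace WeightedC

variable {a b r : ℝ} {ψ : TimeChange a b} {X : Type*} [NormedAddCommGroup X] [NormedSpace ℝ X]

instance : AddCommGroup (WeightedC r ψ X) := inferInstanceAs (AddCommGroup (weightedSubmodule r ψ X))

instance : Module ℝ (WeightedC r ψ X) := inferInstanceAs (Module ℝ (weightedSubmodule r ψ X))

instance : CoeFun (WeightedC r ψ X) (fun _ => Ioc a b → X) := ⟨Subtype.val⟩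

instance : Norm (WeightedC r ψ X) := ⟨fun q => ⨆ t : Ioc a b, ‖(ψ t - ψ a) ^ r • q t‖⟩

theorem norm_def (q : WeightedC r ψ X) : ‖q‖ = ⨆ t : Ioc a b, ‖(ψ t - ψ a) ^ r • q t‖ := rfl

theorem bddAbove (q : WeightedC r ψ X) :
    BddAbove (range fun t : Ioc a b => ‖(ψ t - ψ a) ^ r • q t‖) := by
  obtain ⟨-, g, hg⟩ := q.2
  refine ⟨‖g‖, ?_⟩
  rintro _ ⟨t, rfl⟩
  have h := g.norm_coe_le_norm ⟨t, Ioc_subset_Icc_self t.2⟩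
  rw [hg t] at h
  exact h

theorem core : NormedSpace.Core ℝ (WeightedC r ψ X) where
  norm_nonneg q := Real.iSup_nonneg fun t => norm_nonneg _
  norm_smul c q := by
    rw [norm_def, norm_def, Real.mul_iSup_of_nonneg (norm_nonneg c)]
    refine iSup_congr fun t => ?_
    rw [← norm_smul, smul_comm c]
    rfl
  norm_triangle p q := by
    refine Real.iSup_le (fun t => ?_) (add_nonneg (Real.iSup_nonneg fun t => norm_nonneg _)
      (Real.iSup_nonneg fun t => norm_nonneg _))
    have h : (p + q : WeightedC r ψ X) t = p t + q t := rfl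
    rw [h, smul_add]
    exact (norm_add_le _ _).trans (add_le_add (le_ciSup (bddAbove p) t) (le_ciSup (bddAbove q) t))
  norm_eq_zero_iff q := by
    constructor
    · intro h
      refine Subtype.ext (funext fun t => ?_)
      have h1 : ‖(ψ t - ψ a) ^ r • q t‖ ≤ 0 := h ▸ le_ciSup (bddAbove q) t
      have hab : a ≤ b := (t.2.1.le).trans t.2.2
      have h2 : 0 < (ψ t - ψ a) ^ r := Real.rpow_pos_of_pos
        (sub_pos.2 (ψ.strictMonoOn ⟨le_rfl, hab⟩ (Ioc_subset_Icc_self t.2) t.2.1)) r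
      have h3 := norm_le_zero_iff.1 h1
      exact (smul_eq_zero.1 h3).resolve_left h2.ne'
    · rintro rfl
      have h : ∀ t : Ioc a b, (0 : WeightedC r ψ X) t = 0 := fun t => rfl
      simp [norm_def, h]

instance : NormedAddCommGroup (WeightedC r ψ X) := NormedAddCommGroup.ofCore core

instance : NormedSpace ℝ (WeightedC r ψ X) := NormedSpace.ofCore core

end WeightedC

end PsiHilfer

end

/-!
Why `Λ` is compact. The inclusion `C([a, b], X) → C^{r;ψ}([a, b], X)` with `r = 1 - γ ≥ 0` is
bounded (`WeightedC.ofContinuous`), so it is enough to show that `Λ : L² → C([a, b], X)` is compact.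

The kernel of `Λ` is `K(t, s) = ψ'(s) (ψ(t) - ψ(s))^(α-1) P_α(ψ(t) - ψ(s))` on `a ≤ s < t ≤ b`. Its
values are compact operators, it is norm continuous in `(t, s)`, and by the mean value theorem its
norm is at most `C (t - s)^(α-1)` (`exists_hilfer_kernel`). As `α > 1/2`, the row
`K(t, ·) 1_{s < t}` is in `L²`, and it depends continuously on `t` in `L²`, being a uniform limit of
rows of truncated continuous kernels (`continuous_toLp_kernelRow`). Pairing with an `L²` kernel of
compact operators is a compact operator `L² → X`, by density of simple kernels
(`isCompactOperator_kernelIntegral`). Thus `Λ` is given by a norm continuous family of compact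
operators indexed by `[a, b]`, and Arzelà–Ascoli applies (`isCompactOperator_familyOperator`).

It remains to see that `P_α` is locally bounded and norm continuous on `(0, ∞)`
(`IsC0Semigroup.exists_opP_family`). For `α = 1` this is the norm continuity of a semigroup of
compact operators. For `α < 1` it holds without compactness, because `P_α(t)x` is an integral of
`T(u)x` against a scalar weight that depends on `t` continuously in a weighted `L¹` space. The
semigroup may grow exponentially, so this needs the Wright function to decay faster than every
exponential (`exists_wrightM_le`). That bound comes from a Hankel type integral for `M_α`, obtained
from the power series on the line `Im w = π` with `w = log σ`, where the terms are Gamma integrals.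
The contour is then moved to where `Re e^{αw}` is bounded below by a large positive number.
-/

noncomputable section

namespace PsiHilfer

/-! ### The Wright function -/

/-- The reflection formula in a form that is also correct at the poles of `Γ(1 - s)`: there both
`(Γ(1 - s))⁻¹`, by the convention `Γ = 0` at poles, and `sin (π s)` vanish. -/
theorem inv_Gamma_one_sub {s : ℝ} (hs : 0 < s) :
    (Real.Gamma (1 - s))⁻¹ = Real.Gamma s * Real.sin (Real.pi * s) / Real.pi := by
  have h := Real.Gamma_mul_Gamma_one_sub s
  have hG : Real.Gamma s ≠ 0 := (Real.Gamma_pos_of_pos hs).ne'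
  have h1 : Real.Gamma (1 - s) = Real.pi / Real.sin (Real.pi * s) / Real.Gamma s := by
    rw [← h]; field_simp
  rw [h1, inv_div, div_div_eq_mul_div]

theorem image_exp_univ : Real.exp '' univ = Ioi 0 := by
  rw [image_univ, Real.range_exp]

theorem integrable_exp_neg_exp {z : ℝ} (hz : 0 < z) :
    Integrable (fun x : ℝ => Real.exp (-Real.exp x + z * x)) := by
  have h := Real.GammaIntegral_convergent hz
  rw [← image_exp_univ, integrableOn_image_iff_integrableOn_abs_deriv_smul MeasurableSet.univ
    (fun x _ => (Real.hasDerivAt_exp x).hasDerivWithinAt) Real.exp_injective.injOn,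
    integrableOn_univ] at h
  refine h.congr (ae_of_all _ fun x => ?_)
  simp only [smul_eq_mul]
  rw [abs_of_pos (Real.exp_pos x), ← Real.exp_mul, ← Real.exp_add, ← Real.exp_add]
  ring_nf

/-- The Gamma integral in the variable `x = log u`. -/
theorem integral_exp_neg_exp {z : ℝ} (hz : 0 < z) :
    ∫ x : ℝ, Real.exp (-Real.exp x + z * x) = Real.Gamma z := by
  rw [Real.Gamma_eq_integral hz, ← image_exp_univ,
    integral_image_eq_integral_abs_deriv_smul MeasurableSet.univ
    (fun x _ => (Real.hasDerivAt_exp x).hasDerivWithinAt) Real.exp_injective.injOn,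
    setIntegral_univ]
  refine integral_congr_ae (ae_of_all _ fun x => ?_)
  simp only [smul_eq_mul]
  rw [abs_of_pos (Real.exp_pos x), ← Real.exp_mul, ← Real.exp_add, ← Real.exp_add]
  ring_nf

theorem integrable_exp_neg_mul_exp {κ z : ℝ} (hκ : 0 < κ) (hz : 0 < z) :
    Integrable (fun x : ℝ => Real.exp (-(κ * Real.exp x) + z * x)) := by
  have h := ((integrable_exp_neg_exp hz).comp_add_right (Real.log κ)).const_mul
    (Real.exp (-(z * Real.log κ)))
  refine h.congr (ae_of_all _ fun x => ?_)
  simp only [← Real.exp_add]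
  rw [Real.exp_add x, Real.exp_log hκ]
  ring_nf

/-- Young's inequality in exponential form: `e^{αx}` is dominated by a small multiple of `e^x`. -/
theorem exists_mul_exp_le {α : ℝ} (hα : 0 < α) (hα1 : α < 1) (θ : ℝ) {ε : ℝ} (hε : 0 < ε) :
    ∃ C : ℝ, ∀ x : ℝ, |θ| * Real.exp (α * x) ≤ ε * Real.exp x + C := by
  have hlim : Tendsto (fun c : ℝ => |θ| * α * Real.exp (-((1 - α) * c))) atTop (𝓝 0) := by
    have : Tendsto (fun c : ℝ => Real.exp (-((1 - α) * c))) atTop (𝓝 0) :=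
      Real.tendsto_exp_neg_atTop_nhds_zero.comp
        (tendsto_id.const_mul_atTop (sub_pos.2 hα1))
    simpa using this.const_mul (|θ| * α)
  -- Convexity of `exp` at the points `x` and `c`, with `c` so large that the factor of `e^x` is small.
  obtain ⟨c, hc⟩ := (hlim.eventually (gt_mem_nhds hε)).exists
  refine ⟨|θ| * Real.exp (-((1 - α) * c)) * ((1 - α) * Real.exp c), fun x => ?_⟩
  have hconv := convexOn_exp.2 (mem_univ x) (mem_univ c) hα.le (sub_pos.2 hα1).le (by ring)
  simp only [smul_eq_mul] at hconv
  have h1 : Real.exp (α * x) = Real.exp (-((1 - α) * c)) * Real.exp (α * x + (1 - α) * c) := by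
    rw [← Real.exp_add]; ring_nf
  calc |θ| * Real.exp (α * x)
      = |θ| * Real.exp (-((1 - α) * c)) * Real.exp (α * x + (1 - α) * c) := by rw [h1]; ring
    _ ≤ |θ| * Real.exp (-((1 - α) * c)) * (α * Real.exp x + (1 - α) * Real.exp c) := by
        gcongr
    _ = |θ| * α * Real.exp (-((1 - α) * c)) * Real.exp x +
        |θ| * Real.exp (-((1 - α) * c)) * ((1 - α) * Real.exp c) := by ring
    _ ≤ _ := by gcongr

/-- The entire function `G(w) = exp(e^w - θ e^{αw} + αw)`. In the variable `σ = e^w`, the form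
`G(w) dw` is the integrand `e^{σ - θσ^α} σ^{α-1} dσ` of the Hankel type integral for the Wright
function; working with `w` avoids branches of `σ^α`. -/
def wrightKernel (α θ : ℝ) (w : ℂ) : ℂ :=
  Complex.exp (Complex.exp w - θ * Complex.exp (α * w) + α * w)

theorem differentiable_wrightKernel (α θ : ℝ) : Differentiable ℂ (wrightKernel α θ) := by
  unfold wrightKernel; fun_prop

theorem continuous_wrightKernel (α θ : ℝ) : Continuous (wrightKernel α θ) :=
  (differentiable_wrightKernel α θ).continuous

theorem norm_wrightKernel (α θ x y : ℝ) :
    ‖wrightKernel α θ (x + y * Complex.I)‖ =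
      Real.exp (Real.exp x * Real.cos y - θ * (Real.exp (α * x) * Real.cos (α * y)) + α * x) := by
  rw [wrightKernel, Complex.norm_exp]
  simp [Complex.exp_re]

theorem neg_mul_exp_mul_cos_le (θ u v : ℝ) :
    -(θ * (Real.exp u * Real.cos v)) ≤ |θ| * Real.exp u := by
  refine (neg_le_abs _).trans ?_
  rw [abs_mul, abs_mul, Real.abs_exp]
  exact mul_le_mul_of_nonneg_left
    (mul_le_of_le_one_right (Real.exp_pos _).le (Real.abs_cos_le_one _)) (abs_nonneg _)

theorem wrightKernel_ofReal_im (α θ x : ℝ) : (wrightKernel α θ (x : ℂ)).im = 0 := by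
  have : wrightKernel α θ (x : ℂ) =
      ((Real.exp (Real.exp x - θ * Real.exp (α * x) + α * x) : ℝ) : ℂ) := by
    simp [wrightKernel]
  rw [this, Complex.ofReal_im]

/-- On the line `Im w = π` the kernel is an exponential series whose terms are Gamma integrands. -/
theorem hasSum_wrightKernel_pi (α θ x : ℝ) :
    HasSum (fun n : ℕ => (((-θ) ^ n / (n.factorial : ℝ) : ℝ) : ℂ) *
        Complex.exp (α * (n + 1) * Real.pi * Complex.I) *
        ((Real.exp (-Real.exp x + α * (n + 1) * x) : ℝ) : ℂ))
      (wrightKernel α θ (x + Real.pi * Complex.I)) := by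
  have h := (NormedSpace.expSeries_div_hasSum_exp
    (-θ * Complex.exp (α * (x + Real.pi * Complex.I)) : ℂ)).mul_left
    (Complex.exp (Complex.exp (x + Real.pi * Complex.I) + α * (x + Real.pi * Complex.I)))
  rw [← Complex.exp_eq_exp_ℂ, ← Complex.exp_add] at h
  have e : Complex.exp (x + Real.pi * Complex.I) = -Complex.exp x := by
    rw [Complex.exp_add, Complex.exp_pi_mul_I]; ring
  convert! h using 1
  · funext n
    rw [e, mul_pow, ← Complex.exp_nat_mul]
    push_cast
    have e2 : Complex.exp (α * (n + 1) * Real.pi * Complex.I) *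
        Complex.exp (-Complex.exp x + α * (n + 1) * x) =
        Complex.exp (-Complex.exp x + α * (x + Real.pi * Complex.I)) *
          Complex.exp (n * (α * (x + Real.pi * Complex.I))) := by
      rw [← Complex.exp_add, ← Complex.exp_add]
      ring_nf
    linear_combination ((-θ : ℂ) ^ n / n.factorial) * e2
  · rw [wrightKernel]
    congr 1
    ring

theorem norm_exp_ofReal_mul_pi_mul_I (c : ℝ) :
    ‖Complex.exp (c * Real.pi * Complex.I)‖ = 1 := by
  have := Complex.norm_exp_ofReal_mul_I (c * Real.pi)
  simpa using this

/-- The integrable majorant on a line `Im w = φ` with `cos φ = -κ < 0`: since `α < 1`, the term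
`e^{αx}` is absorbed by `κ e^x`, whatever its coefficient. -/
theorem integrable_exp_majorant {α : ℝ} (hα : 0 < α) (hα1 : α < 1) (θ : ℝ) {κ : ℝ} (hκ : 0 < κ) :
    Integrable (fun x : ℝ =>
      Real.exp (-(κ * Real.exp x) + |θ| * Real.exp (α * x) + α * x)) := by
  obtain ⟨C, hC⟩ := exists_mul_exp_le hα hα1 θ (half_pos hκ)
  refine ((integrable_exp_neg_mul_exp (half_pos hκ) hα).const_mul (Real.exp C)).mono'
    (by fun_prop) (ae_of_all _ fun x => ?_)
  rw [Real.norm_eq_abs, Real.abs_exp, ← Real.exp_add, Real.exp_le_exp]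
  have := hC x
  linarith

/-- Termwise integration of the series along the line `Im w = π`. -/
theorem hasSum_integral_wrightKernel_pi {α : ℝ} (hα : 0 < α) (hα1 : α < 1) (θ : ℝ) :
    HasSum (fun n : ℕ => (((-θ) ^ n / (n.factorial : ℝ) : ℝ) : ℂ) *
        Complex.exp (α * (n + 1) * Real.pi * Complex.I) * (Real.Gamma (α * (n + 1)) : ℝ))
      (∫ x : ℝ, wrightKernel α θ (x + Real.pi * Complex.I)) := by
  have hsum : ∀ x : ℝ, HasSum (fun n : ℕ => |θ| ^ n / (n.factorial : ℝ) *
        Real.exp (-Real.exp x + α * (n + 1) * x))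
      (Real.exp (-(1 * Real.exp x) + |θ| * Real.exp (α * x) + α * x)) := fun x => by
    have h := (NormedSpace.expSeries_div_hasSum_exp (|θ| * Real.exp (α * x))).mul_left
      (Real.exp (-Real.exp x + α * x))
    rw [← Real.exp_eq_exp_ℝ, ← Real.exp_add] at h
    convert! h using 1
    · funext n
      rw [mul_pow, ← Real.exp_nat_mul, mul_div_right_comm, mul_left_comm, ← Real.exp_add]
      ring_nf
    · ring_nf
  have h := hasSum_integral_of_dominated_convergence (μ := (volume : Measure ℝ))
    (F := fun (n : ℕ) (x : ℝ) => (((-θ) ^ n / (n.factorial : ℝ) : ℝ) : ℂ) *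
        Complex.exp (α * (n + 1) * Real.pi * Complex.I) *
        ((Real.exp (-Real.exp x + α * (n + 1) * x) : ℝ) : ℂ))
    (f := fun x : ℝ => wrightKernel α θ (x + Real.pi * Complex.I))
    (fun (n : ℕ) (x : ℝ) => |θ| ^ n / (n.factorial : ℝ) * Real.exp (-Real.exp x + α * (n + 1) * x))
    (fun n => Continuous.aestronglyMeasurable (by fun_prop))
    (fun n => ae_of_all _ fun x => ?_)
    (ae_of_all _ fun x => (hsum x).summable)
    (by
      simp_rw [fun x => (hsum x).tsum_eq]
      exact integrable_exp_majorant hα hα1 θ one_pos)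
    (ae_of_all _ fun x => hasSum_wrightKernel_pi α θ x)
  · convert! h using 1
    funext n
    rw [integral_const_mul, integral_complex_ofReal, integral_exp_neg_exp (by positivity)]
  · have := norm_exp_ofReal_mul_pi_mul_I (α * (n + 1))
    push_cast at this
    rw [norm_mul, norm_mul, this, Complex.norm_real, Complex.norm_real, norm_div, norm_pow, norm_neg]
    simp

theorem hasSum_wrightM {α : ℝ} (hα : 0 < α) (hα1 : α < 1) (θ : ℝ) :
    HasSum (fun n : ℕ => (-θ) ^ n / ((n.factorial : ℝ) * Real.Gamma (1 - α * ((n : ℝ) + 1))))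
      ((∫ x : ℝ, wrightKernel α θ (x + Real.pi * Complex.I)).im / Real.pi) := by
  have h := (Complex.imCLM.hasSum (hasSum_integral_wrightKernel_pi hα hα1 θ)).div_const Real.pi
  simp only [Complex.imCLM_apply] at h
  convert! h using 1
  funext n
  have hn : 0 < α * ((n : ℝ) + 1) := by positivity
  have e : Complex.exp (α * (n + 1) * Real.pi * Complex.I) =
      Complex.exp ((Real.pi * (α * (n + 1)) : ℝ) * Complex.I) := by
    push_cast; ring_nf
  rw [← div_div, div_eq_mul_inv _ (Real.Gamma _), inv_Gamma_one_sub hn, Complex.im_mul_ofReal,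
    Complex.im_ofReal_mul, e, Complex.exp_ofReal_mul_I_im]
  ring

/-- The Wright function as a contour integral along the line `Im w = π`. The lines `Im w = ±π` are
complex conjugate, which accounts for the imaginary part. -/
theorem wrightM_eq {α : ℝ} (hα : 0 < α) (hα1 : α < 1) (θ : ℝ) :
    wrightM α θ = (∫ x : ℝ, wrightKernel α θ (x + Real.pi * Complex.I)).im / Real.pi :=
  (hasSum_wrightM hα hα1 θ).tsum_eq

/-- The Wright function is continuous: its power series converges absolutely on every bounded
interval. -/
theorem continuous_wrightM {α : ℝ} (hα : 0 < α) (hα1 : α < 1) : Continuous (wrightM α) := by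
  refine continuous_iff_continuousAt.2 fun θ₀ => ?_
  set r : ℝ := |θ₀| + 1
  have hs : Summable fun n : ℕ =>
      ‖(-r) ^ n / ((n.factorial : ℝ) * Real.Gamma (1 - α * ((n : ℝ) + 1)))‖ :=
    (hasSum_wrightM hα hα1 r).summable.norm
  have hc : ContinuousOn (wrightM α) (Metric.ball 0 r) := by
    refine continuousOn_tsum (fun n => by fun_prop) hs fun n θ hθ => ?_
    rw [mem_ball_zero_iff] at hθ
    rw [norm_div, norm_div, norm_pow, norm_pow, norm_neg, norm_neg]
    gcongr
    exact hθ.le.trans (le_abs_self r)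
  refine hc.continuousAt (Metric.isOpen_ball.mem_nhds ?_)
  rw [mem_ball_zero_iff, Real.norm_eq_abs]
  exact lt_add_one _

/-- Cauchy's theorem on the right half-strip `Re w > L`, `c < Im w < d`, for an entire function
whose integrals over the far vertical edges tend to zero. -/
theorem integral_Ioi_sub_integral_Ioi {f : ℂ → ℂ} (hf : Differentiable ℂ f) (L c d : ℝ)
    (hc : IntegrableOn (fun x : ℝ => f (x + c * Complex.I)) (Ioi L))
    (hd : IntegrableOn (fun x : ℝ => f (x + d * Complex.I)) (Ioi L))
    (hlim : Tendsto (fun N : ℝ => ∫ y : ℝ in c..d, f (N + y * Complex.I)) atTop (𝓝 0)) :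
    (∫ x : ℝ in Ioi L, f (x + c * Complex.I)) - (∫ x : ℝ in Ioi L, f (x + d * Complex.I)) =
      Complex.I * ∫ y : ℝ in c..d, f (L + y * Complex.I) := by
  have hN : ∀ N : ℝ, (∫ x : ℝ in L..N, f (x + c * Complex.I)) -
      (∫ x : ℝ in L..N, f (x + d * Complex.I)) +
      Complex.I * (∫ y : ℝ in c..d, f (N + y * Complex.I)) =
      Complex.I * (∫ y : ℝ in c..d, f (L + y * Complex.I)) := fun N => by
    have h := Complex.integral_boundary_rect_eq_zero_of_differentiableOn f
      (L + c * Complex.I) (N + d * Complex.I) hf.differentiableOn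
    simp only [Complex.add_re, Complex.ofReal_re, Complex.mul_re, Complex.I_re, mul_zero,
      Complex.ofReal_im, Complex.I_im, sub_self, add_zero, Complex.add_im,
      Complex.mul_im, mul_one, zero_add, smul_eq_mul] at h
    linear_combination h
  have h1 := ((intervalIntegral_tendsto_integral_Ioi L hc tendsto_id).sub
    (intervalIntegral_tendsto_integral_Ioi L hd tendsto_id)).add (hlim.const_mul Complex.I)
  simp only [id] at h1
  rw [mul_zero, add_zero] at h1
  exact tendsto_nhds_unique (h1.congr hN) tendsto_const_nhds |>.symm ▸ rfl

/-- Cauchy's theorem on the left half-strip `Re w < L`, `c < Im w < d`, in the limiting form that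
does not require integrability along the lower edge. -/
theorem tendsto_integral_lower_edge {f : ℂ → ℂ} (hf : Differentiable ℂ f) (L c d : ℝ)
    (hd : IntegrableOn (fun x : ℝ => f (x + d * Complex.I)) (Iic L))
    (hlim : Tendsto (fun N : ℝ => ∫ y : ℝ in c..d, f (N + y * Complex.I)) atBot (𝓝 0)) :
    Tendsto (fun N : ℝ => ∫ x : ℝ in N..L, f (x + c * Complex.I)) atBot
      (𝓝 ((∫ x : ℝ in Iic L, f (x + d * Complex.I)) -
        Complex.I * ∫ y : ℝ in c..d, f (L + y * Complex.I))) := by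
  have hN : ∀ N : ℝ, (∫ x : ℝ in N..L, f (x + d * Complex.I)) -
      Complex.I * (∫ y : ℝ in c..d, f (L + y * Complex.I)) +
      Complex.I * (∫ y : ℝ in c..d, f (N + y * Complex.I)) =
      ∫ x : ℝ in N..L, f (x + c * Complex.I) := fun N => by
    have h := Complex.integral_boundary_rect_eq_zero_of_differentiableOn f
      (N + c * Complex.I) (L + d * Complex.I) hf.differentiableOn
    simp only [Complex.add_re, Complex.ofReal_re, Complex.mul_re, Complex.I_re, mul_zero,
      Complex.ofReal_im, Complex.I_im, sub_self, add_zero, Complex.add_im,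
      Complex.mul_im, mul_one, zero_add, smul_eq_mul] at h
    linear_combination -h
  have h1 := ((intervalIntegral_tendsto_integral_Iic L hd tendsto_id).sub_const
    (Complex.I * ∫ y : ℝ in c..d, f (L + y * Complex.I))).add (hlim.const_mul Complex.I)
  simp only [id] at h1
  rw [mul_zero, add_zero] at h1
  exact h1.congr hN

/-- On a line `Im w = φ` with `cos φ < 0` the kernel is integrable. -/
theorem integrable_wrightKernel {α : ℝ} (hα : 0 < α) (hα1 : α < 1) (θ : ℝ) {φ : ℝ}
    (hφ : Real.cos φ < 0) :
    Integrable (fun x : ℝ => wrightKernel α θ (x + φ * Complex.I)) := by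
  refine (integrable_exp_majorant hα hα1 θ (neg_pos.2 hφ)).mono'
    (((continuous_wrightKernel α θ).comp (by fun_prop)).aestronglyMeasurable)
    (ae_of_all _ fun x => ?_)
  rw [norm_wrightKernel, Real.exp_le_exp]
  have h := neg_mul_exp_mul_cos_le θ (α * x) (α * φ)
  linarith

theorem tendsto_integral_wrightKernel_atBot {α : ℝ} (hα : 0 < α) (θ c d : ℝ) :
    Tendsto (fun N : ℝ => ∫ y : ℝ in c..d, wrightKernel α θ (N + y * Complex.I)) atBot (𝓝 0) := by
  have h1 : Tendsto (fun N : ℝ => Real.exp (α * N)) atBot (𝓝 0) :=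
    Real.tendsto_exp_atBot.comp (tendsto_id.const_mul_atBot hα)
  have h2 : Tendsto (fun N : ℝ => Real.exp (Real.exp N + |θ| * Real.exp (α * N)) *
      Real.exp (α * N) * |d - c|) atBot (𝓝 0) := by
    have := (((Real.continuous_exp.tendsto _).comp
      (Real.tendsto_exp_atBot.add (h1.const_mul |θ|))).mul h1).mul_const |d - c|
    simpa using this
  refine squeeze_zero_norm (fun N => ?_) h2
  refine intervalIntegral.norm_integral_le_of_norm_le_const fun y _ => ?_
  rw [norm_wrightKernel, ← Real.exp_add, Real.exp_le_exp]
  have h := neg_mul_exp_mul_cos_le θ (α * N) (α * y)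
  have h' : Real.exp N * Real.cos y ≤ Real.exp N :=
    mul_le_of_le_one_right (Real.exp_pos _).le (Real.cos_le_one _)
  linarith

theorem tendsto_integral_wrightKernel_atTop {α : ℝ} (hα : 0 < α) (hα1 : α < 1) (θ : ℝ) {φ : ℝ}
    (hφ : Real.cos φ < 0) (hφ0 : 0 ≤ φ) (hφπ : φ ≤ Real.pi) :
    Tendsto (fun N : ℝ => ∫ y : ℝ in φ..Real.pi, wrightKernel α θ (N + y * Complex.I))
      atTop (𝓝 0) := by
  obtain ⟨C, hC⟩ := exists_mul_exp_le hα hα1 θ (half_pos (neg_pos.2 hφ))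
  obtain ⟨C', hC'⟩ := exists_mul_exp_le hα hα1 1 (half_pos (half_pos (neg_pos.2 hφ)))
  have hlim : Tendsto (fun N : ℝ => Real.exp (C + C' + Real.cos φ / 2 / 2 * Real.exp N) *
      |Real.pi - φ|) atTop (𝓝 0) := by
    have h1 : Tendsto (fun N : ℝ => C + C' + Real.cos φ / 2 / 2 * Real.exp N) atTop atBot :=
      tendsto_atBot_add_const_left _ _
        (Real.tendsto_exp_atTop.const_mul_atTop_of_neg (by linarith))
    simpa using (Real.tendsto_exp_atBot.comp h1).mul_const |Real.pi - φ|
  refine squeeze_zero_norm (fun N => ?_) hlim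
  refine intervalIntegral.norm_integral_le_of_norm_le_const fun y hy => ?_
  rw [uIoc_of_le hφπ] at hy
  rw [norm_wrightKernel, Real.exp_le_exp]
  have h1 := neg_mul_exp_mul_cos_le θ (α * N) (α * y)
  have h2 : Real.exp N * Real.cos y ≤ Real.exp N * Real.cos φ :=
    mul_le_mul_of_nonneg_left (Real.cos_le_cos_of_nonneg_of_le_pi hφ0 hy.2 hy.1.le)
      (Real.exp_pos N).le
  have h3 := hC N
  have h4 := hC' N
  rw [abs_one, one_mul] at h4
  have h5 := Real.add_one_le_exp (α * N)
  nlinarith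

/-- Deformation of the contour: the line `Im w = π` is replaced by the vertical segment from `L` to
`L + iφ` followed by the half-line from `L + iφ` to `+∞ + iφ`. The path from `-∞` to `L` along the
real axis, where the kernel is real, contributes nothing to the imaginary part. -/
theorem im_integral_wrightKernel_pi {α : ℝ} (hα : 0 < α) (hα1 : α < 1) (θ : ℝ) {φ : ℝ}
    (hφ : Real.cos φ < 0) (hφ0 : 0 ≤ φ) (hφπ : φ ≤ Real.pi) (L : ℝ) :
    (∫ x : ℝ, wrightKernel α θ (x + Real.pi * Complex.I)).im =
      ((∫ x : ℝ in Ioi L, wrightKernel α θ (x + φ * Complex.I)) +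
        Complex.I * ∫ y : ℝ in (0 : ℝ)..φ, wrightKernel α θ (L + y * Complex.I)).im := by
  have hπ : Real.cos Real.pi < 0 := by simp
  have hint := integrable_wrightKernel hα hα1 θ hπ
  have hD := differentiable_wrightKernel α θ
  have hc := continuous_wrightKernel α θ
  have h1 := integral_Ioi_sub_integral_Ioi hD L φ Real.pi
    (integrable_wrightKernel hα hα1 θ hφ).integrableOn hint.integrableOn
    (tendsto_integral_wrightKernel_atTop hα hα1 θ hφ hφ0 hφπ)
  have h2 := (Complex.continuous_im.tendsto _).comp
    (tendsto_integral_lower_edge hD L 0 Real.pi hint.integrableOn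
    (tendsto_integral_wrightKernel_atBot hα θ 0 Real.pi))
  -- The kernel is real on the real axis, so the lower edge contributes no imaginary part.
  have h3 : ∀ N : ℝ, (∫ x : ℝ in N..L, wrightKernel α θ (x + (0 : ℝ) * Complex.I)).im = 0 := by
    intro N
    have e : ∀ x : ℝ, wrightKernel α θ (x + (0 : ℝ) * Complex.I) =
        (((wrightKernel α θ x).re : ℝ) : ℂ) := fun x => by
      rw [Complex.ofReal_zero, zero_mul, add_zero]
      exact Complex.ext rfl (by simp [wrightKernel_ofReal_im])
    simp_rw [e]
    rw [intervalIntegral.integral_ofReal, Complex.ofReal_im]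
  have h4 := tendsto_nhds_unique (h2.congr h3) tendsto_const_nhds
  have h5 := intervalIntegral.integral_add_adjacent_intervals (μ := volume)
    (f := fun y : ℝ => wrightKernel α θ (L + y * Complex.I)) (a := 0) (b := φ) (c := Real.pi)
    ((hc.comp (by fun_prop)).intervalIntegrable _ _)
    ((hc.comp (by fun_prop)).intervalIntegrable _ _)
  rw [← intervalIntegral.integral_Iic_add_Ioi (b := L) hint.integrableOn hint.integrableOn]
  have h6 : (∫ x : ℝ in Ioi L, wrightKernel α θ (x + φ * Complex.I)) +
        Complex.I * (∫ y : ℝ in (0 : ℝ)..φ, wrightKernel α θ (L + y * Complex.I)) =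
      (∫ x : ℝ in Ioi L, wrightKernel α θ (x + Real.pi * Complex.I)) +
        Complex.I * ∫ y : ℝ in (0 : ℝ)..Real.pi, wrightKernel α θ (L + y * Complex.I) := by
    rw [← h5]
    linear_combination h1
  rw [h6, Complex.add_im, Complex.add_im]
  rw [Complex.sub_im] at h4
  linarith

/-- The Wright function decays faster than any exponential. The constant `C` depends on `k`: for
large `k` the vertical edge of the contour has to be moved to the right until `e^{αL} cos(αφ)`
exceeds `k`. -/
theorem exists_wrightM_le {α : ℝ} (hα : 0 < α) (hα1 : α < 1) (k : ℝ) :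
    ∃ C : ℝ, ∀ θ : ℝ, 0 ≤ θ → |wrightM α θ| ≤ C * Real.exp (-(k * θ)) := by
  -- The angle `φ` satisfies `cos φ < 0 < cos (α φ)`; this is possible because `α < 1`.
  obtain ⟨φ, hφ1, hφ2⟩ : ∃ φ, Real.pi / 2 < φ ∧ φ < min Real.pi (Real.pi / (2 * α)) := by
    refine exists_between (lt_min (by linarith [Real.pi_pos]) ?_)
    exact div_lt_div_of_pos_left Real.pi_pos (by positivity) (by linarith)
  rw [lt_min_iff, lt_div_iff₀ (by positivity)] at hφ2
  have hpi := Real.pi_pos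
  have hφ0 : 0 ≤ φ := by linarith
  have hαφ : 0 ≤ α * φ := by positivity
  have hcos : Real.cos φ < 0 :=
    Real.cos_neg_of_pi_div_two_lt_of_lt hφ1 (by linarith)
  have hcos' : 0 < Real.cos (α * φ) :=
    Real.cos_pos_of_mem_Ioo ⟨by linarith, by linarith⟩
  set s := Real.cos (α * φ)
  obtain ⟨L, hL⟩ : ∃ L : ℝ, k ≤ Real.exp (α * L) * s := by
    have : Tendsto (fun L : ℝ => Real.exp (α * L) * s) atTop atTop :=
      (Real.tendsto_exp_atTop.comp (tendsto_id.const_mul_atTop hα)).atTop_mul_const hcos'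
    exact (this.eventually_ge_atTop k).exists
  set J : ℝ := ∫ x : ℝ in Ioi L, Real.exp (-(-Real.cos φ * Real.exp x) + α * x)
  refine ⟨(J + Real.exp (Real.exp L + α * L) * |φ - 0|) / Real.pi, fun θ hθ => ?_⟩
  rw [wrightM_eq hα hα1, im_integral_wrightKernel_pi hα hα1 θ hcos hφ0 hφ2.1.le L, abs_div,
    abs_of_pos hpi, div_mul_eq_mul_div]
  gcongr
  refine (Complex.abs_im_le_norm _).trans ((norm_add_le _ _).trans ?_)
  rw [add_mul]
  have hk : ∀ u c : ℝ, Real.exp (α * L) ≤ u → s ≤ c → -(θ * (u * c)) ≤ -(k * θ) := by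
    intro u c hu hc
    have : k ≤ u * c := hL.trans (mul_le_mul hu hc hcos'.le ((Real.exp_pos _).le.trans hu))
    nlinarith
  refine add_le_add ?_ ?_
  · rw [← integral_mul_const]
    refine norm_integral_le_of_norm_le
      ((integrable_exp_neg_mul_exp (neg_pos.2 hcos) hα).integrableOn.mul_const _) ?_
    refine (ae_restrict_iff' measurableSet_Ioi).2 (ae_of_all _ fun x hx => ?_)
    rw [norm_wrightKernel, ← Real.exp_add, Real.exp_le_exp]
    have := hk (Real.exp (α * x)) s
      (Real.exp_le_exp.2 (mul_le_mul_of_nonneg_left (le_of_lt hx) hα.le)) le_rfl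
    linarith
  · rw [norm_mul, Complex.norm_I, one_mul]
    have : ∀ y ∈ uIoc 0 φ, ‖wrightKernel α θ (L + y * Complex.I)‖ ≤
        Real.exp (Real.exp L + α * L) * Real.exp (-(k * θ)) := by
      intro y hy
      rw [uIoc_of_le hφ0] at hy
      rw [norm_wrightKernel, ← Real.exp_add, Real.exp_le_exp]
      have h1 := hk (Real.exp (α * L)) (Real.cos (α * y)) le_rfl
        (Real.cos_le_cos_of_nonneg_of_le_pi (mul_nonneg hα.le hy.1.le) (by linarith)
          (mul_le_mul_of_nonneg_left hy.2 hα.le))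
      have h2 : Real.exp L * Real.cos y ≤ Real.exp L :=
        mul_le_of_le_one_right (Real.exp_pos _).le (Real.cos_le_one _)
      linarith
    refine (intervalIntegral.norm_integral_le_of_norm_le_const this).trans (le_of_eq ?_)
    ring

/-! ### Growth and continuity of a `C₀`-semigroup -/

namespace IsC0Semigroup

variable {X : Type*} [NormedAddCommGroup X] [NormedSpace ℝ X] {T : ℝ → X →L[ℝ] X}

theorem tendsto_apply_zero (hT : IsC0Semigroup T) (x : X) :
    Tendsto (fun t : ℝ => T t x) (𝓝[≥] 0) (𝓝 x) := by
  have h : ContinuousWithinAt (fun t : ℝ => T t x) (Ioi 0) 0 := by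
    rw [ContinuousWithinAt, hT.map_zero]
    exact hT.strong_continuity x
  have h' := continuousWithinAt_Ioi_iff_Ici.1 h
  rw [ContinuousWithinAt, hT.map_zero] at h'
  exact h'

theorem exists_norm_le_of_small [CompleteSpace X] (hT : IsC0Semigroup T) :
    ∃ δ > 0, ∃ M : ℝ, ∀ t ∈ Icc 0 δ, ‖T t‖ ≤ M := by
  by_contra! h
  choose u hu hun using fun n : ℕ => h (1 / ((n : ℝ) + 1)) Nat.one_div_pos_of_nat n
  have hu0 : Tendsto u atTop (𝓝[≥] 0) :=
    tendsto_nhdsWithin_iff.2 ⟨squeeze_zero (fun n => (hu n).1) (fun n => (hu n).2)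
      tendsto_one_div_add_atTop_nhds_zero_nat, Eventually.of_forall fun n => (hu n).1⟩
  obtain ⟨C, hC⟩ := banach_steinhaus (g := fun n => T (u n)) fun x => by
    obtain ⟨C, hC⟩ := ((hT.tendsto_apply_zero x).comp hu0).norm.bddAbove_range
    exact ⟨C, fun n => hC ⟨n, rfl⟩⟩
  obtain ⟨n, hn⟩ := exists_nat_gt C
  exact absurd (hC n) (not_le.2 (hn.trans (hun n)))

/-- A `C₀`-semigroup is exponentially bounded. -/
theorem exists_norm_le_exp [CompleteSpace X] (hT : IsC0Semigroup T) :
    ∃ M > 0, ∃ ω > 0, ∀ t : ℝ, 0 ≤ t → ‖T t‖ ≤ M * Real.exp (ω * t) := by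
  obtain ⟨δ, hδ, M₀, hM₀⟩ := hT.exists_norm_le_of_small
  set M := max M₀ 2
  have hM1 : 1 < M := one_lt_two.trans_le (le_max_right _ _)
  have hM : ∀ t ∈ Icc 0 δ, ‖T t‖ ≤ M := fun t ht => (hM₀ t ht).trans (le_max_left _ _)
  have hind : ∀ n : ℕ, ∀ t : ℝ, 0 ≤ t → t ≤ (n + 1) * δ → ‖T t‖ ≤ M ^ (n + 1) := by
    intro n
    induction n with
    | zero => intro t h0 h1; simpa using hM t ⟨h0, by simpa using h1⟩
    | succ n ih =>
      intro t h0 h1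
      rcases le_total t δ with h | h
      · exact (hM t ⟨h0, h⟩).trans (le_self_pow₀ hM1.le (by omega))
      · have e : T t = (T δ).comp (T (t - δ)) := by
          rw [← hT.map_add δ (t - δ) hδ.le (sub_nonneg.2 h)]; congr 1; ring
        rw [e, pow_succ']
        refine (ContinuousLinearMap.opNorm_comp_le _ _).trans
          (mul_le_mul (hM δ ⟨hδ.le, le_rfl⟩) (ih _ (sub_nonneg.2 h) ?_) (norm_nonneg _)
            (by positivity))
        push_cast at h1
        linarith
  have hlog := Real.log_pos hM1
  refine ⟨M, by positivity, Real.log M / δ, by positivity, fun t ht => ?_⟩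
  have h1 := hind ⌊t / δ⌋₊ t ht (by
    have := (Nat.lt_floor_add_one (t / δ)).le
    rwa [div_le_iff₀ hδ] at this)
  refine h1.trans ?_
  rw [pow_succ']
  gcongr
  rw [← Real.rpow_natCast, Real.rpow_def_of_pos (by positivity), Real.exp_le_exp, div_mul_eq_mul_div,
    mul_div_assoc]
  gcongr
  exact Nat.floor_le (by positivity)

theorem continuousOn_apply [CompleteSpace X] (hT : IsC0Semigroup T) (x : X) :
    ContinuousOn (fun t : ℝ => T t x) (Ici 0) := by
  obtain ⟨M, hM, ω, hω, hTM⟩ := hT.exists_norm_le_exp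
  intro t (ht : 0 ≤ t)
  rw [ContinuousWithinAt, tendsto_iff_norm_sub_tendsto_zero]
  have hsub : Tendsto (fun s : ℝ => |s - t|) (𝓝[≥] t ⊔ 𝓝[<] t) (𝓝[≥] 0) := by
    rw [sup_comm, nhdsLT_sup_nhdsGE]
    refine tendsto_nhdsWithin_iff.2 ⟨?_, Eventually.of_forall fun s => mem_Ici.2 (abs_nonneg _)⟩
    have : Continuous fun s : ℝ => |s - t| := by fun_prop
    simpa using this.tendsto t
  rw [sup_comm, nhdsLT_sup_nhdsGE] at hsub
  have h1 := ((tendsto_iff_norm_sub_tendsto_zero.1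
    ((hT.tendsto_apply_zero x).comp hsub)).const_mul (M * Real.exp (ω * t))).mono_left
    (nhdsWithin_le_nhds (s := Ici 0))
  rw [mul_zero] at h1
  refine squeeze_zero' (Eventually.of_forall fun s => norm_nonneg _) ?_ h1
  filter_upwards [self_mem_nhdsWithin] with s (hs : 0 ≤ s)
  -- The difference is `T (min s t)` applied to `±(T |s - t| x - x)`.
  have key : ∀ u v : ℝ, 0 ≤ u → u ≤ v → u ≤ t →
      ‖T v x - T u x‖ ≤ M * Real.exp (ω * t) * ‖T (v - u) x - x‖ := by
    intro u v hu huv hut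
    have e : T v x = T u (T (v - u) x) := by
      rw [← ContinuousLinearMap.comp_apply, ← hT.map_add u (v - u) hu (sub_nonneg.2 huv)]
      congr 2; ring
    rw [e, ← map_sub]
    refine ((T u).le_opNorm _).trans ?_
    gcongr
    exact (hTM u hu).trans (by gcongr)
  simp only [Function.comp_apply]
  rcases le_total s t with h | h
  · rw [norm_sub_rev, abs_of_nonpos (sub_nonpos.2 h), neg_sub]
    exact key s t hs h h
  · rw [abs_of_nonneg (sub_nonneg.2 h)]
    exact key t s ht h le_rfl

end IsC0Semigroup

/-! ### Norm continuity of the operators `P_α(t)` -/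

section

variable {X : Type*} [NormedAddCommGroup X] [NormedSpace ℝ X] {T : ℝ → X →L[ℝ] X}

/-- Strong convergence of a bounded family becomes norm convergence after composition with a
compact operator, because it is uniform on relatively compact sets. -/
theorem tendsto_comp_isCompactOperator {ι : Type*} {l : Filter ι} {S : ι → X →L[ℝ] X}
    {S₀ K : X →L[ℝ] X} (hK : IsCompactOperator K) {C : ℝ} (hC : ∀ᶠ i in l, ‖S i‖ ≤ C)
    (hS : ∀ x, Tendsto (fun i => S i x) l (𝓝 (S₀ x))) :
    Tendsto (fun i => (S i).comp K) l (𝓝 (S₀.comp K)) := by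
  rw [Metric.tendsto_nhds]
  intro ε hε
  obtain ⟨δ, hδ, hδε⟩ : ∃ δ > 0, (|C| + 1 + ‖S₀‖) * δ < ε := by
    refine ⟨ε / 2 / (|C| + 1 + ‖S₀‖), by positivity, ?_⟩
    rw [mul_div_cancel₀ _ (by positivity)]
    linarith
  obtain ⟨Q, hQ, hKQ⟩ := IsCompactOperator.image_closedBall_subset_compact
    (f := (K : X →ₗ[ℝ] X)) hK 1
  obtain ⟨t, -, htf, htQ⟩ := hQ.finite_cover_balls hδ
  have hev : ∀ᶠ i in l, ∀ y ∈ t, dist (S i y) (S₀ y) < δ :=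
    (eventually_all_finite htf).2 fun y _ => (Metric.tendsto_nhds.1 (hS y)) δ hδ
  filter_upwards [hC, hev] with i hi hit
  rw [dist_eq_norm]
  refine lt_of_le_of_lt (ContinuousLinearMap.opNorm_le_of_unit_norm (by positivity) ?_) hδε
  intro x hx
  have hx' : K x ∈ Q := hKQ ⟨x, by simp [hx], rfl⟩
  obtain ⟨y, hy, hxy⟩ := mem_iUnion₂.1 (htQ hx')
  rw [Metric.mem_ball, dist_eq_norm] at hxy
  have h1 := hit y hy
  rw [dist_eq_norm] at h1
  have e : (S i).comp K x - S₀.comp K x = S i (K x - y) + (S i y - S₀ y) - S₀ (K x - y) := by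
    simp only [ContinuousLinearMap.comp_apply, map_sub]; abel
  rw [_root_.sub_apply, e]
  calc _ ≤ ‖S i (K x - y)‖ + ‖S i y - S₀ y‖ + ‖S₀ (K x - y)‖ :=
        (norm_sub_le _ _).trans (add_le_add_left (norm_add_le _ _) _)
    _ ≤ |C| * δ + δ + ‖S₀‖ * δ := by
        gcongr
        · exact (S i).le_of_opNorm_le_of_le (hi.trans (le_abs_self C)) hxy.le
        · exact S₀.le_of_opNorm_le_of_le le_rfl hxy.le
    _ = _ := by ring

/-- A `C₀`-semigroup of compact operators is norm continuous on `(0, ∞)`. -/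
theorem IsC0Semigroup.continuousOn_of_isCompactOperator [CompleteSpace X] (hT : IsC0Semigroup T)
    (hc : ∀ t : ℝ, 0 < t → IsCompactOperator (T t)) : ContinuousOn T (Ioi 0) := by
  obtain ⟨M, hM, ω, hω, hTM⟩ := hT.exists_norm_le_exp
  intro t (ht : 0 < t)
  -- Near `t` one has `T s = T (s - t / 2) T (t / 2)`, with a fixed compact factor on the right.
  have ht2 : 0 < t / 2 := half_pos ht
  have hev : ∀ᶠ s in 𝓝 t, t / 2 < s := lt_mem_nhds (by linarith)
  have key : Tendsto (fun s : ℝ => (T (s - t / 2)).comp (T (t / 2))) (𝓝 t)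
      (𝓝 ((T (t - t / 2)).comp (T (t / 2)))) := by
    refine tendsto_comp_isCompactOperator (hc _ ht2) (C := M * Real.exp (ω * t)) ?_ fun x => ?_
    · filter_upwards [hev, gt_mem_nhds (show t < t + t / 2 by linarith)] with s hs hs'
      refine (hTM _ (by linarith)).trans ?_
      gcongr
      linarith
    · have h1 := (hT.continuousOn_apply x).continuousAt
        (Ici_mem_nhds (show 0 < t - t / 2 by linarith))
      exact ContinuousAt.comp (f := fun s : ℝ => s - t / 2) h1 (by fun_prop)
  have e : ∀ s : ℝ, t / 2 < s → (T (s - t / 2)).comp (T (t / 2)) = T s := fun s hs => by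
    rw [← hT.map_add _ _ (by linarith) ht2.le, sub_add_cancel]
  rw [e t (by linarith)] at key
  refine ContinuousAt.continuousWithinAt (key.congr' ?_)
  filter_upwards [hev] with s hs using e s hs

/-- Averaging a `C₀`-semigroup against a continuous weight `m` that decays faster than any
exponential gives bounded operators `Q(τ)x = ∫₀^∞ m(θ) T(τθ)x dθ`. They are norm continuous in
`τ > 0` even if `T` is not: after the substitution `u = τθ` the parameter `τ` enters only through
the scalar weight `τ⁻¹ m(u / τ)`. -/
theorem IsC0Semigroup.exists_weighted_average [CompleteSpace X] (hT : IsC0Semigroup T) {m : ℝ → ℝ}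
    (hmc : Continuous m)
    (hm : ∀ k : ℝ, ∃ C : ℝ, ∀ θ : ℝ, 0 ≤ θ → |m θ| ≤ C * Real.exp (-(k * θ))) :
    ∃ Q : ℝ → X →L[ℝ] X,
      (∀ τ : ℝ, 0 < τ → ∀ x, Q τ x = ∫ θ in Ioi (0 : ℝ), m θ • T (τ * θ) x) ∧
      (∀ R : ℝ, ∃ C : ℝ, ∀ τ ∈ Ioc 0 R, ‖Q τ‖ ≤ C) ∧ ContinuousOn Q (Ioi 0) := by
  obtain ⟨M, hM, ω, hω, hTM⟩ := hT.exists_norm_le_exp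
  -- Pointwise bound on the integrand, uniform for `0 ≤ τ ≤ R`.
  have hbound : ∀ R : ℝ, ∃ C : ℝ, 0 ≤ C ∧ ∀ τ ∈ Icc 0 R, ∀ θ : ℝ, 0 ≤ θ → ∀ x : X,
      ‖m θ • T (τ * θ) x‖ ≤ Real.exp (-θ) * (C * ‖x‖) := by
    intro R
    obtain ⟨C, hC⟩ := hm (ω * R + 1)
    have hC0 : 0 ≤ C := by simpa using (abs_nonneg _).trans (hC 0 le_rfl)
    refine ⟨C * M, by positivity, fun τ hτ θ hθ x => ?_⟩
    have h1 : ‖T (τ * θ) x‖ ≤ M * Real.exp (ω * (R * θ)) * ‖x‖ := by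
      refine (T _).le_of_opNorm_le ((hTM _ (mul_nonneg hτ.1 hθ)).trans ?_) x
      gcongr
      exact hτ.2
    have h2 : Real.exp (-θ) = Real.exp (-((ω * R + 1) * θ)) * Real.exp (ω * (R * θ)) := by
      rw [← Real.exp_add]; ring_nf
    rw [norm_smul, Real.norm_eq_abs, h2]
    calc |m θ| * ‖T (τ * θ) x‖
        ≤ (C * Real.exp (-((ω * R + 1) * θ))) * (M * Real.exp (ω * (R * θ)) * ‖x‖) := by
          gcongr; exact hC θ hθ
      _ = _ := by ring
  have hexp : IntegrableOn (fun θ : ℝ => Real.exp (-θ)) (Ioi 0) := integrableOn_exp_neg_Ioi 0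
  have hint : ∀ τ : ℝ, 0 ≤ τ → ∀ x : X,
      IntegrableOn (fun θ => m θ • T (τ * θ) x) (Ioi 0) := by
    intro τ hτ x
    obtain ⟨C, -, hC⟩ := hbound τ
    refine Integrable.mono' (hexp.mul_const (C * ‖x‖)) ?_
      ((ae_restrict_iff' measurableSet_Ioi).2 (ae_of_all _ fun θ (hθ : 0 < θ) =>
        hC τ ⟨hτ, le_rfl⟩ θ hθ.le x))
    refine ContinuousOn.aestronglyMeasurable ?_ measurableSet_Ioi
    refine hmc.continuousOn.smul ((hT.continuousOn_apply x).comp (by fun_prop) ?_)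
    exact fun θ (hθ : 0 < θ) => mul_nonneg hτ hθ.le
  have hnorm : ∀ R : ℝ, ∃ C : ℝ, 0 ≤ C ∧ ∀ τ ∈ Icc 0 R, ∀ x : X,
      ‖∫ θ in Ioi (0 : ℝ), m θ • T (τ * θ) x‖ ≤ C * ‖x‖ := by
    intro R
    obtain ⟨C, hC0, hC⟩ := hbound R
    refine ⟨C, hC0, fun τ hτ x => ?_⟩
    refine (norm_integral_le_of_norm_le (hexp.mul_const (C * ‖x‖))
      ((ae_restrict_iff' measurableSet_Ioi).2 (ae_of_all _ fun θ (hθ : 0 < θ) =>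
        hC τ hτ θ hθ.le x))).trans (le_of_eq ?_)
    rw [integral_mul_const, integral_exp_neg_Ioi_zero, one_mul]
  choose C hC0 hC using hnorm
  -- Replacing `τ` by `max τ 0` makes the formula meaningful for every real `τ`.
  let Q : ℝ → X →L[ℝ] X := fun τ => LinearMap.mkContinuous
    { toFun := fun x => ∫ θ in Ioi (0 : ℝ), m θ • T (max τ 0 * θ) x
      map_add' := fun x y => by
        rw [← integral_add (hint _ (le_max_right _ _) x) (hint _ (le_max_right _ _) y)]
        congr 1
        funext θ
        rw [_root_.map_add, smul_add]
      map_smul' := fun c x => by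
        rw [RingHom.id_apply, ← integral_smul]
        congr 1
        funext θ
        rw [map_smul, smul_comm] }
    (C (max τ 0)) fun x => hC _ _ ⟨le_max_right _ _, le_rfl⟩ x
  have hQ : ∀ τ : ℝ, 0 < τ → ∀ x, Q τ x = ∫ θ in Ioi (0 : ℝ), m θ • T (τ * θ) x := by
    intro τ hτ x
    change (∫ θ in Ioi (0 : ℝ), m θ • T (max τ 0 * θ) x) = _
    rw [max_eq_left hτ.le]
  refine ⟨Q, hQ, fun R => ⟨C R, fun τ hτ => ?_⟩, fun τ₀ (hτ₀ : 0 < τ₀) => ?_⟩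
  · refine ContinuousLinearMap.opNorm_le_bound _ (hC0 R) fun x => ?_
    rw [hQ τ hτ.1]
    exact hC R τ ⟨hτ.1.le, hτ.2⟩ x
  have hQ' : ∀ τ : ℝ, 0 < τ → ∀ x,
      IntegrableOn (fun u => (τ⁻¹ * m (τ⁻¹ * u)) • T u x) (Ioi 0) ∧
      Q τ x = ∫ u in Ioi (0 : ℝ), (τ⁻¹ * m (τ⁻¹ * u)) • T u x := by
    intro τ hτ x
    have hτ' : 0 < τ⁻¹ := inv_pos.2 hτ
    constructor
    · have h1 := hint τ hτ.le x
      have h2 := (integrableOn_Ioi_comp_mul_left_iff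
        (fun u => (τ⁻¹ * m (τ⁻¹ * u)) • T u x) 0 hτ).1
      rw [mul_zero] at h2
      refine h2 ?_
      refine (h1.smul τ⁻¹).congr (ae_of_all _ fun u => ?_)
      simp only [Pi.smul_apply]
      rw [inv_mul_cancel_left₀ hτ.ne', smul_smul]
    · have h2 := integral_comp_mul_left_Ioi (fun u => (τ⁻¹ * m (τ⁻¹ * u)) • T u x) 0 hτ
      rw [mul_zero] at h2
      simp only [inv_mul_cancel_left₀ hτ.ne', mul_smul] at h2
      rw [integral_smul] at h2
      rw [hQ τ hτ]
      have h3 := smul_right_injective X hτ'.ne' h2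
      simpa only [mul_smul] using h3
  -- `‖Q τ - Q τ₀‖ ≤ D τ`, and `D τ → 0` by dominated convergence.
  set D : ℝ → ℝ := fun τ => ∫ u in Ioi (0 : ℝ),
    |τ⁻¹ * m (τ⁻¹ * u) - τ₀⁻¹ * m (τ₀⁻¹ * u)| * (M * Real.exp (ω * u))
  obtain ⟨B, hB⟩ := hm (2 * τ₀ * (ω + 1))
  have hB0 : 0 ≤ B := by simpa using (abs_nonneg _).trans (hB 0 le_rfl)
  have hloc : ∀ τ : ℝ, τ₀ / 2 < τ → τ < 2 * τ₀ → ∀ u : ℝ, 0 ≤ u →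
      |τ⁻¹ * m (τ⁻¹ * u)| ≤ 2 * τ₀⁻¹ * (B * Real.exp (-((ω + 1) * u))) := by
    intro τ h1 h2 u hu
    have hτ : 0 < τ := by linarith
    have h3 : τ⁻¹ ≤ 2 * τ₀⁻¹ := by
      rw [inv_le_comm₀ hτ (by positivity), mul_inv, inv_inv]; linarith
    rw [abs_mul, abs_of_pos (inv_pos.2 hτ)]
    refine mul_le_mul h3 ((hB _ (by positivity)).trans ?_) (abs_nonneg _) (by positivity)
    refine mul_le_mul_of_nonneg_left (Real.exp_le_exp.2 (neg_le_neg ?_)) hB0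
    have h4 : 1 ≤ 2 * τ₀ * τ⁻¹ := by
      rw [← div_eq_mul_inv, le_div_iff₀ hτ]; linarith
    calc (ω + 1) * u ≤ (2 * τ₀ * τ⁻¹) * ((ω + 1) * u) := le_mul_of_one_le_left (by positivity) h4
      _ = _ := by ring
  have hdom : ∀ τ : ℝ, τ₀ / 2 < τ → τ < 2 * τ₀ → ∀ u : ℝ, 0 ≤ u →
      |τ⁻¹ * m (τ⁻¹ * u) - τ₀⁻¹ * m (τ₀⁻¹ * u)| * (M * Real.exp (ω * u)) ≤
        Real.exp (-u) * (4 * τ₀⁻¹ * B * M) := by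
    intro τ h1 h2 u hu
    have h3 := hloc τ h1 h2 u hu
    have h4 := hloc τ₀ (by linarith) (by linarith) u hu
    have h5 : Real.exp (-u) = Real.exp (-((ω + 1) * u)) * Real.exp (ω * u) := by
      rw [← Real.exp_add]; ring_nf
    calc _ ≤ (4 * τ₀⁻¹ * (B * Real.exp (-((ω + 1) * u)))) * (M * Real.exp (ω * u)) := by
          gcongr
          refine (abs_sub _ _).trans ?_
          linarith
      _ = _ := by rw [h5]; ring
  have hnear : ∀ᶠ τ in 𝓝 τ₀, τ₀ / 2 < τ ∧ τ < 2 * τ₀ :=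
    (lt_mem_nhds (by linarith)).and (gt_mem_nhds (by linarith))
  have hmeas : ∀ τ : ℝ, AEStronglyMeasurable (fun u : ℝ =>
      |τ⁻¹ * m (τ⁻¹ * u) - τ₀⁻¹ * m (τ₀⁻¹ * u)| * (M * Real.exp (ω * u)))
      (volume.restrict (Ioi 0)) := fun τ => Continuous.aestronglyMeasurable (by fun_prop)
  have hD : Tendsto D (𝓝 τ₀) (𝓝 0) := by
    have h := tendsto_integral_filter_of_dominated_convergence (μ := volume.restrict (Ioi (0 : ℝ)))
      (l := 𝓝 τ₀) (F := fun (τ u : ℝ) =>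
        |τ⁻¹ * m (τ⁻¹ * u) - τ₀⁻¹ * m (τ₀⁻¹ * u)| * (M * Real.exp (ω * u)))
      (f := fun _ => 0) (fun u => Real.exp (-u) * (4 * τ₀⁻¹ * B * M))
      (Eventually.of_forall hmeas) ?_ (hexp.mul_const _) ?_
    · simpa using h
    · filter_upwards [hnear] with τ hτ
      refine (ae_restrict_iff' measurableSet_Ioi).2 (ae_of_all _ fun u (hu : 0 < u) => ?_)
      rw [Real.norm_of_nonneg (by positivity)]
      exact hdom τ hτ.1 hτ.2 u hu.le
    · refine ae_of_all _ fun u => ?_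
      have hc : ContinuousAt (fun τ : ℝ =>
          |τ⁻¹ * m (τ⁻¹ * u) - τ₀⁻¹ * m (τ₀⁻¹ * u)| * (M * Real.exp (ω * u))) τ₀ := by
        have : ContinuousAt (fun τ : ℝ => τ⁻¹) τ₀ := continuousAt_inv₀ hτ₀.ne'
        fun_prop
      simpa [ContinuousAt] using hc
  refine ContinuousAt.continuousWithinAt ?_
  rw [ContinuousAt, tendsto_iff_norm_sub_tendsto_zero]
  refine squeeze_zero' (Eventually.of_forall fun _ => norm_nonneg _) ?_ hD
  filter_upwards [hnear] with τ hτ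
  have hτ0 : 0 < τ := by linarith
  refine ContinuousLinearMap.opNorm_le_bound _
    (integral_nonneg fun u => by positivity) fun x => ?_
  rw [_root_.sub_apply, (hQ' τ hτ0 x).2, (hQ' τ₀ hτ₀ x).2,
    ← integral_sub (hQ' τ hτ0 x).1 (hQ' τ₀ hτ₀ x).1, ← integral_mul_const]
  refine norm_integral_le_of_norm_le (Integrable.mul_const ?_ _) ?_
  · refine Integrable.mono' (hexp.mul_const (4 * τ₀⁻¹ * B * M)) (hmeas τ)
      ((ae_restrict_iff' measurableSet_Ioi).2 (ae_of_all _ fun u (hu : 0 < u) => ?_))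
    rw [Real.norm_of_nonneg (by positivity)]
    exact hdom τ hτ.1 hτ.2 u hu.le
  · refine (ae_restrict_iff' measurableSet_Ioi).2 (ae_of_all _ fun u (hu : 0 < u) => ?_)
    rw [← sub_smul, norm_smul, Real.norm_eq_abs, mul_assoc]
    gcongr
    exact (T u).le_of_opNorm_le (hTM u hu.le) x

/-- The operators `P_α(t)`, `t > 0`, as a locally bounded and norm continuous family of bounded
linear operators. Compactness is needed for norm continuity only when `α = 1`. -/
theorem IsC0Semigroup.exists_opP_family [CompleteSpace X] (hT : IsC0Semigroup T) {α : ℝ}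
    (hα : 0 < α) (hα1 : α ≤ 1) (hP : ∀ t : ℝ, 0 < t → IsCompactOperator (opP α T t)) :
    ∃ P : ℝ → X →L[ℝ] X, (∀ t : ℝ, 0 < t → ⇑(P t) = opP α T t) ∧
      (∀ R : ℝ, ∃ C : ℝ, ∀ t ∈ Ioc 0 R, ‖P t‖ ≤ C) ∧ ContinuousOn P (Ioi 0) := by
  rcases eq_or_lt_of_le hα1 with rfl | hlt
  · have e : ∀ t, ⇑(T t) = opP 1 T t := fun t => by funext x; simp [opP]
    refine ⟨T, fun t _ => e t, fun R => ?_,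
      hT.continuousOn_of_isCompactOperator fun t ht => by rw [e]; exact hP t ht⟩
    obtain ⟨M, hM, ω, hω, hTM⟩ := hT.exists_norm_le_exp
    refine ⟨M * Real.exp (ω * R), fun t ht => (hTM t ht.1.le).trans ?_⟩
    gcongr
    exact ht.2
  · have hmc : Continuous fun θ : ℝ => α * θ * wrightM α θ :=
      (continuous_const.mul continuous_id).mul (continuous_wrightM hα hlt)
    obtain ⟨Q, hQ, hQb, hQc⟩ := hT.exists_weighted_average hmc fun k => by
      obtain ⟨C, hC⟩ := exists_wrightM_le hα hlt (k + 1)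
      refine ⟨α * C, fun θ hθ => ?_⟩
      have h1 : θ ≤ Real.exp θ := by linarith [Real.add_one_le_exp θ]
      have hC0 : 0 ≤ C := by simpa using (abs_nonneg _).trans (hC 0 le_rfl)
      rw [abs_mul, abs_mul, abs_of_pos hα, abs_of_nonneg hθ]
      calc α * θ * |wrightM α θ| ≤ α * Real.exp θ * (C * Real.exp (-((k + 1) * θ))) := by
            gcongr; exact hC θ hθ
        _ = α * C * (Real.exp θ * Real.exp (-((k + 1) * θ))) := by ring
        _ = _ := by rw [← Real.exp_add]; ring_nf
    refine ⟨fun t => Q (t ^ α), fun t ht => ?_, fun R => ?_, ?_⟩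
    · funext x
      rw [hQ _ (Real.rpow_pos_of_pos ht α), opP, if_neg hlt.ne]
    · obtain ⟨C, hC⟩ := hQb (R ^ α)
      exact ⟨C, fun t ht => hC _ ⟨Real.rpow_pos_of_pos ht.1 α,
        Real.rpow_le_rpow ht.1.le ht.2 hα.le⟩⟩
    · refine hQc.comp ?_ fun t (ht : 0 < t) => Real.rpow_pos_of_pos ht α
      exact (Real.continuous_rpow_const hα.le).continuousOn

end

/-! ### Compactness of weakly singular Volterra operators -/

section CompactFamilies

variable {E F : Type*} [NormedAddCommGroup E] [NormedSpace ℝ E] [NormedAddCommGroup F]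
  [NormedSpace ℝ F]

/-- A norm continuous family `Ψ` of bounded operators `E → F`, indexed by a compact space `S`,
as a single operator `E → C(S, F)`, `f ↦ (t ↦ Ψ t f)`. -/
def familyOperator {S : Type*} [TopologicalSpace S] [CompactSpace S] (Ψ : C(S, E →L[ℝ] F)) :
    E →L[ℝ] C(S, F) :=
  LinearMap.mkContinuous
    { toFun := fun f => ⟨fun t => Ψ t f, by fun_prop⟩
      map_add' := fun f g => by ext t; simp
      map_smul' := fun c f => by ext t; simp }
    ‖Ψ‖ fun f => by
      refine (ContinuousMap.norm_le _ (by positivity)).2 fun t => ?_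
      exact (Ψ t).le_of_opNorm_le (Ψ.norm_coe_le_norm t) f

theorem familyOperator_apply {S : Type*} [TopologicalSpace S] [CompactSpace S]
    (Ψ : C(S, E →L[ℝ] F)) (f : E) (t : S) : familyOperator Ψ f t = Ψ t f := rfl

/-- If all members of the family are compact operators, so is the operator into `C(S, F)`, by the
Arzelà–Ascoli theorem. -/
theorem isCompactOperator_familyOperator [CompleteSpace F] {S : Type*} [TopologicalSpace S]
    [CompactSpace S] (Ψ : C(S, E →L[ℝ] F)) (hΨ : ∀ t, IsCompactOperator (Ψ t)) :
    IsCompactOperator (familyOperator Ψ) := by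
  refine (isCompactOperator_iff_isCompact_closure_image_closedBall
    (familyOperator Ψ : E →ₗ[ℝ] C(S, F)) one_pos).2 ?_
  have : T2Space (UniformOnFun S F {K : Set S | IsCompact K}) :=
    UniformOnFun.t2Space_of_covering
      (eq_univ_of_forall fun t => mem_sUnion_of_mem (mem_singleton t) isCompact_singleton)
  refine ArzelaAscoli.isCompact_closure_of_isClosedEmbedding (F := fun g : C(S, F) => (g : S → F))
    (𝔖 := {K | IsCompact K}) (fun K hK => hK)
    ContinuousMap.isUniformEmbedding_toUniformOnFunIsCompact.isClosedEmbedding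
    (fun K _ => Equicontinuous.equicontinuousOn (fun t₀ => ?_) K) fun K _ t _ => ?_
  · rw [Metric.equicontinuousAt_iff_right]
    intro ε hε
    filter_upwards [Metric.tendsto_nhds.1 (Ψ.continuous.tendsto t₀) ε hε] with t ht
    rintro ⟨_, f, hf, rfl⟩
    rw [mem_closedBall_zero_iff] at hf
    rw [dist_comm, dist_eq_norm] at ht
    refine lt_of_le_of_lt ?_ ht
    change dist (Ψ t₀ f) (Ψ t f) ≤ _
    rw [dist_eq_norm, ← _root_.sub_apply]
    exact (Ψ t₀ - Ψ t).unit_le_opNorm f hf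
  · obtain ⟨Q, hQ, hQs⟩ := IsCompactOperator.image_closedBall_subset_compact
      (f := (Ψ t : E →ₗ[ℝ] F)) (hΨ t) 1
    refine ⟨Q, hQ, ?_⟩
    rintro _ ⟨f, hf, rfl⟩
    exact hQs ⟨f, hf, rfl⟩

end CompactFamilies

section Pairing

variable {X : Type*} [NormedAddCommGroup X] [NormedSpace ℝ X] [CompleteSpace X]
  {G : Type*} [NormedAddCommGroup G] [NormedSpace ℝ G]

/-- The operator `f ↦ ∫ κ(s) f(s) ds` from `L²` to `X`, for an `L²` kernel `κ` with values in a
normed space `G` that acts on `X` through `B`. -/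
def kernelIntegral (B : G →L[ℝ] X →L[ℝ] X) (μ : Measure ℝ) :
    Lp G 2 μ →L[ℝ] Lp X 2 μ →L[ℝ] X :=
  ContinuousLinearMap.lpPairing μ 2 2 B

theorem kernelIntegral_apply (B : G →L[ℝ] X →L[ℝ] X) (μ : Measure ℝ) (κ : Lp G 2 μ)
    (f : Lp X 2 μ) : kernelIntegral B μ κ f = ∫ s, B (κ s) (f s) ∂μ :=
  ContinuousLinearMap.lpPairing_eq_integral _ _ _

/-- Compact operators form a closed set, so by density it suffices to treat a kernel that is
constant on a set and zero elsewhere. For such a kernel the operator is a compact operator after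
`f ↦ ∫_A f`. -/
theorem isCompactOperator_kernelIntegral {B : G →L[ℝ] X →L[ℝ] X}
    (hB : ∀ c, IsCompactOperator (B c)) (μ : Measure ℝ) (κ : Lp G 2 μ) :
    IsCompactOperator (kernelIntegral B μ κ) := by
  refine Lp.induction ENNReal.ofNat_ne_top
    (motive := fun κ => IsCompactOperator (kernelIntegral B μ κ)) (fun c s hs hμs => ?_)
    (fun f g hf hg _ h1 h2 => ?_) ?_ κ
  · rw [Lp.simpleFunc.coe_indicatorConst]
    let J : Lp X 2 μ →L[ℝ] X :=
      ContinuousLinearMap.lpPairing μ 2 2 (ContinuousLinearMap.lsmul ℝ ℝ)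
        (indicatorConstLp 2 hs hμs.ne (1 : ℝ))
    have e : (kernelIntegral B μ (indicatorConstLp 2 hs hμs.ne c)) = (B c).comp J := by
      ext f
      have hJ : J f = ∫ s, (indicatorConstLp 2 hs hμs.ne (1 : ℝ) s) • f s ∂μ :=
        ContinuousLinearMap.lpPairing_eq_integral _ _ _
      have hint : Integrable (fun x => (indicatorConstLp 2 hs hμs.ne (1 : ℝ) x) • f x) μ :=
        memLp_one_iff_integrable.1 ((ContinuousLinearMap.lsmul ℝ ℝ).memLp_of_bilin 1
          (Lp.memLp (indicatorConstLp 2 hs hμs.ne (1 : ℝ))) (Lp.memLp f))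
      rw [kernelIntegral_apply, ContinuousLinearMap.comp_apply, hJ,
        ← ContinuousLinearMap.integral_comp_comm _ hint]
      refine integral_congr_ae ?_
      filter_upwards [indicatorConstLp_coeFn (p := 2) (hs := hs) (hμs := hμs.ne) (c := c),
        indicatorConstLp_coeFn (p := 2) (hs := hs) (hμs := hμs.ne) (c := (1 : ℝ))] with x h1 h2
      rw [h1, h2]
      by_cases hx : x ∈ s <;> simp [hx]
    rw [e]
    exact IsCompactOperator.comp_clm (hB c) J
  · rw [_root_.map_add]
    exact h1.add h2
  · exact isClosed_setOfPred_isCompactOperator.preimage (kernelIntegral B μ).continuous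

end Pairing

section Singular

variable {E : Type*} [NormedAddCommGroup E]

/-- The singular weight `v ↦ v^(α-1)` cut off outside `(0, δ]`. -/
def cutPow (α δ : ℝ) : ℝ → ℝ := (Ioc 0 δ).indicator fun v => v ^ (α - 1)

theorem measurable_cutPow (α δ : ℝ) : Measurable (cutPow α δ) :=
  (measurable_id.pow_const _).indicator measurableSet_Ioc

theorem cutPow_nonneg (α δ v : ℝ) : 0 ≤ cutPow α δ v :=
  indicator_nonneg (fun _ hv => Real.rpow_nonneg hv.1.le _) _

theorem cutPow_sq (α δ v : ℝ) :
    cutPow α δ v ^ 2 = (Ioc 0 δ).indicator (fun v => v ^ (2 * α - 2)) v := by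
  by_cases hv : v ∈ Ioc 0 δ
  · rw [cutPow, indicator_of_mem hv, indicator_of_mem hv, ← Real.rpow_natCast,
      ← Real.rpow_mul hv.1.le]
    congr 1; push_cast; ring
  · rw [cutPow, indicator_of_notMem hv, indicator_of_notMem hv]; simp

/-- Square integrability at `0` amounts to `2α - 2 > -1`. -/
theorem memLp_cutPow {α : ℝ} (hα : 1 / 2 < α) {δ : ℝ} (hδ : 0 ≤ δ) :
    MemLp (cutPow α δ) 2 volume := by
  refine (memLp_two_iff_integrable_sq (measurable_cutPow α δ).aestronglyMeasurable).2 ?_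
  simp_rw [cutPow_sq]
  rw [integrable_indicator_iff measurableSet_Ioc,
    ← intervalIntegrable_iff_integrableOn_Ioc_of_le hδ]
  exact intervalIntegral.intervalIntegrable_rpow' (by linarith)

theorem eLpNorm_cutPow {α : ℝ} (hα : 1 / 2 < α) {δ : ℝ} (hδ : 0 ≤ δ) :
    eLpNorm (cutPow α δ) 2 volume =
      ENNReal.ofReal ((δ ^ (2 * α - 1) / (2 * α - 1)) ^ (2⁻¹ : ℝ)) := by
  rw [(memLp_cutPow hα hδ).eLpNorm_eq_integral_rpow_norm two_ne_zero ENNReal.ofNat_ne_top]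
  have h : ∀ v, ‖cutPow α δ v‖ ^ (2 : ENNReal).toReal =
      (Ioc 0 δ).indicator (fun v => v ^ (2 * α - 2)) v := fun v => by
    rw [← cutPow_sq, Real.norm_of_nonneg (cutPow_nonneg _ _ _)]
    norm_num
  simp_rw [h]
  rw [integral_indicator measurableSet_Ioc, ← intervalIntegral.integral_of_le hδ,
    integral_rpow (Or.inl (by linarith)), Real.zero_rpow (by linarith), sub_zero]
  norm_num
  ring_nf

theorem exists_eLpNorm_cutPow_le {α : ℝ} (hα : 1 / 2 < α) {ε : ℝ} (hε : 0 < ε) :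
    ∃ δ > 0, eLpNorm (cutPow α δ) 2 volume ≤ ENNReal.ofReal ε := by
  have hlim : Tendsto (fun δ : ℝ => (δ ^ (2 * α - 1) / (2 * α - 1)) ^ (2⁻¹ : ℝ)) (𝓝 0) (𝓝 0) := by
    have hc : Continuous fun δ : ℝ => (δ ^ (2 * α - 1) / (2 * α - 1)) ^ (2⁻¹ : ℝ) :=
      (Real.continuous_rpow_const (by norm_num)).comp
        ((Real.continuous_rpow_const (by linarith)).div_const _)
    have := hc.tendsto 0
    rwa [Real.zero_rpow (by linarith), zero_div, Real.zero_rpow (by norm_num)] at this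
  obtain ⟨δ, hδε, hδ⟩ := (((hlim.eventually (gt_mem_nhds hε)).filter_mono
    (nhdsWithin_le_nhds (s := Ioi 0))).and self_mem_nhdsWithin).exists
  exact ⟨δ, hδ, by rw [eLpNorm_cutPow hα (le_of_lt hδ)]; exact ENNReal.ofReal_le_ofReal hδε.le⟩

theorem eLpNorm_le_cutPow {α C δ t : ℝ} {μ : Measure ℝ} (hμ : μ ≤ volume) {f : ℝ → E}
    (hf : ∀ᵐ s ∂μ, ‖f s‖ ≤ C * cutPow α δ (t - s)) :
    eLpNorm f 2 μ ≤ ENNReal.ofReal C * eLpNorm (cutPow α δ) 2 volume := by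
  have h1 : eLpNorm (fun s => cutPow α δ (t - s)) 2 μ ≤ eLpNorm (cutPow α δ) 2 volume := by
    refine (eLpNorm_mono_measure _ hμ).trans (le_of_eq ?_)
    exact eLpNorm_comp_measurePreserving (measurable_cutPow α δ).aestronglyMeasurable
      (Measure.measurePreserving_sub_left volume t)
  refine (eLpNorm_le_mul_eLpNorm_of_ae_le_mul (g := fun s => cutPow α δ (t - s)) ?_ 2).trans
    (by gcongr)
  filter_upwards [hf] with s hs
  rwa [Real.norm_of_nonneg (cutPow_nonneg _ _ _)]

/-- The domain `a ≤ s < t ≤ b` of a Volterra kernel, as a set of pairs `(t, s)`. -/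
def triangle (a b : ℝ) : Set (ℝ × ℝ) := {p | a ≤ p.2 ∧ p.2 < p.1 ∧ p.1 ≤ b}

/-- The row `K(t, ·)` of a Volterra kernel, extended by `0` to `s ≥ t`. -/
def kernelRow (K : ℝ → ℝ → E) (t : ℝ) : ℝ → E := (Iio t).indicator (K t)

/-- A continuous cutoff that vanishes for `v ≤ δ` and equals `1` for `v ≥ 2δ`. -/
def cutoff (δ v : ℝ) : ℝ := max 0 (min 1 (v / δ - 1))

theorem continuous_cutoff (δ : ℝ) : Continuous (cutoff δ) := by
  unfold cutoff; fun_prop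

theorem cutoff_nonneg (δ v : ℝ) : 0 ≤ cutoff δ v := le_max_left _ _

theorem cutoff_le_one (δ v : ℝ) : cutoff δ v ≤ 1 := max_le zero_le_one (min_le_left _ _)

theorem cutoff_eq_zero {δ v : ℝ} (hδ : 0 < δ) (hv : v ≤ δ) : cutoff δ v = 0 := by
  have : v / δ ≤ 1 := (div_le_one hδ).2 hv
  exact max_eq_left ((min_le_right _ _).trans (by linarith))

theorem cutoff_eq_one {δ v : ℝ} (hδ : 0 < δ) (hv : 2 * δ ≤ v) : cutoff δ v = 1 := by
  have : 2 ≤ v / δ := (le_div_iff₀ hδ).2 hv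
  rw [cutoff, min_eq_left (by linarith), max_eq_right zero_le_one]

variable {a b α C : ℝ} {K : ℝ → ℝ → E}

theorem norm_kernelRow_le (hKb : ∀ p ∈ triangle a b, ‖K p.1 p.2‖ ≤ C * (p.1 - p.2) ^ (α - 1))
    {t s : ℝ} (ht : t ≤ b) (hs : a ≤ s) :
    ‖kernelRow K t s‖ ≤ C * cutPow α (b - a) (t - s) := by
  by_cases h : s < t
  · rw [kernelRow, indicator_of_mem (mem_Iio.2 h), cutPow,
      indicator_of_mem (show t - s ∈ Ioc 0 (b - a) from ⟨by linarith, by linarith⟩)]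
    exact hKb (t, s) ⟨hs, h, ht⟩
  · rw [kernelRow, indicator_of_notMem (by simpa using h), cutPow,
      indicator_of_notMem (fun h' => h (by linarith [h'.1]))]
    simp

theorem aestronglyMeasurable_kernelRow (hKc : ContinuousOn (Function.uncurry K) (triangle a b))
    {t : ℝ} (ht : t ≤ b) :
    AEStronglyMeasurable (kernelRow K t) (volume.restrict (Icc a b)) := by
  rw [kernelRow, aestronglyMeasurable_indicator_iff measurableSet_Iio,
    Measure.restrict_restrict measurableSet_Iio]
  refine ContinuousOn.aestronglyMeasurable ?_ (measurableSet_Iio.inter measurableSet_Icc)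
  exact hKc.comp (f := fun s : ℝ => (t, s)) (by fun_prop) fun s hs => ⟨hs.2.1, hs.1, ht⟩

theorem memLp_kernelRow (hab : a ≤ b) (hα : 1 / 2 < α)
    (hKc : ContinuousOn (Function.uncurry K) (triangle a b))
    (hKb : ∀ p ∈ triangle a b, ‖K p.1 p.2‖ ≤ C * (p.1 - p.2) ^ (α - 1)) {t : ℝ} (ht : t ≤ b) :
    MemLp (kernelRow K t) 2 (volume.restrict (Icc a b)) := by
  refine ⟨aestronglyMeasurable_kernelRow hKc ht, lt_of_le_of_lt (eLpNorm_le_cutPow (α := α) (C := C)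
    (δ := b - a) (t := t) Measure.restrict_le_self ?_)
    (ENNReal.mul_lt_top ENNReal.ofReal_lt_top (memLp_cutPow hα (sub_nonneg.2 hab)).2)⟩
  exact (ae_restrict_iff' measurableSet_Icc).2 (ae_of_all _ fun s hs =>
    norm_kernelRow_le hKb ht hs.1)

variable [NormedSpace ℝ E]

/-- The cutoff removes the singularity at `s = t`, and the truncated kernel is continuous on the
whole square. -/
theorem continuousOn_truncated (hKc : ContinuousOn (Function.uncurry K) (triangle a b))
    {δ : ℝ} (hδ : 0 < δ) :
    ContinuousOn (fun p : ℝ × ℝ => cutoff δ (p.1 - p.2) • kernelRow K p.1 p.2)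
      (Icc a b ×ˢ Icc a b) := by
  rintro ⟨t, s⟩ ⟨ht, hs⟩
  by_cases h : s < t
  · have hopen : IsOpen {p : ℝ × ℝ | p.2 < p.1} := isOpen_lt continuous_snd continuous_fst
    have hnhds : {p : ℝ × ℝ | p.2 < p.1} ∈ 𝓝 (t, s) := hopen.mem_nhds h
    rw [← continuousWithinAt_inter hnhds]
    have h1 : ContinuousOn (fun p : ℝ × ℝ => cutoff δ (p.1 - p.2) • K p.1 p.2)
        ((Icc a b ×ˢ Icc a b) ∩ {p | p.2 < p.1}) :=
      (((continuous_cutoff δ).comp (by fun_prop)).continuousOn).smul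
        (hKc.mono fun p hp => ⟨hp.1.2.1, hp.2, hp.1.1.2⟩)
    refine (h1.congr fun p hp => ?_) (t, s) ⟨⟨ht, hs⟩, h⟩
    simp only [kernelRow]
    rw [indicator_of_mem (mem_Iio.2 hp.2)]
  · have hnhds : ∀ᶠ p : ℝ × ℝ in 𝓝 (t, s), p.1 - p.2 < δ := by
      have hc : Continuous fun p : ℝ × ℝ => p.1 - p.2 := by fun_prop
      exact (hc.tendsto (t, s)).eventually (gt_mem_nhds (by simp only; linarith))
    refine ContinuousAt.continuousWithinAt ?_
    refine (continuousAt_const (y := (0 : E))).congr ?_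
    filter_upwards [hnhds] with p hp
    rw [cutoff_eq_zero hδ hp.le, zero_smul]

theorem memLp_truncated (hab : a ≤ b) (hα : 1 / 2 < α)
    (hKc : ContinuousOn (Function.uncurry K) (triangle a b))
    (hKb : ∀ p ∈ triangle a b, ‖K p.1 p.2‖ ≤ C * (p.1 - p.2) ^ (α - 1)) (δ : ℝ) {t : ℝ}
    (ht : t ≤ b) :
    MemLp (fun s => cutoff δ (t - s) • kernelRow K t s) 2 (volume.restrict (Icc a b)) := by
  have h := memLp_kernelRow hab hα hKc hKb ht
  refine h.of_le (((continuous_cutoff δ).comp (by fun_prop)).aestronglyMeasurable.smul h.1)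
    (ae_of_all _ fun s => ?_)
  rw [norm_smul, Real.norm_of_nonneg (cutoff_nonneg _ _)]
  exact mul_le_of_le_one_left (norm_nonneg _) (cutoff_le_one _ _)

theorem continuous_toLp_truncated (hab : a ≤ b) (hα : 1 / 2 < α)
    (hKc : ContinuousOn (Function.uncurry K) (triangle a b))
    (hKb : ∀ p ∈ triangle a b, ‖K p.1 p.2‖ ≤ C * (p.1 - p.2) ^ (α - 1)) {δ : ℝ} (hδ : 0 < δ) :
    Continuous fun t : Icc a b => (memLp_truncated hab hα hKc hKb δ t.2.2).toLp := by
  have hu := (isCompact_Icc.prod isCompact_Icc).uniformContinuousOn_of_continuous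
    (continuousOn_truncated hKc hδ)
  rw [Metric.uniformContinuousOn_iff_le] at hu
  set A : ℝ := measureUnivNNReal (volume.restrict (Icc a b)) ^ ((2 : ENNReal).toReal)⁻¹ with hA
  have hA0 : 0 ≤ A := by positivity
  refine Metric.continuous_iff.2 fun t₀ ε hε => ?_
  obtain ⟨η, hη, hηu⟩ := hu (ε / (A + 1)) (by positivity)
  refine ⟨η, hη, fun t ht => ?_⟩
  rw [dist_eq_norm, ← MemLp.toLp_sub]
  refine lt_of_le_of_lt (Lp.norm_le_of_ae_bound (C := ε / (A + 1)) (by positivity) ?_) ?_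
  · filter_upwards [MemLp.coeFn_toLp ((memLp_truncated hab hα hKc hKb δ t.2.2).sub
      (memLp_truncated hab hα hKc hKb δ t₀.2.2)), ae_restrict_mem measurableSet_Icc] with s hs hs'
    rw [hs, Pi.sub_apply, ← dist_eq_norm]
    refine hηu (t, s) ⟨t.2, hs'⟩ (t₀, s) ⟨t₀.2, hs'⟩ ?_
    rw [Prod.dist_eq, dist_self]
    exact max_le ht.le hη.le
  · rw [← hA, mul_div_assoc', div_lt_iff₀ (by positivity)]
    nlinarith

/-- The rows of a weakly singular Volterra kernel depend continuously on `t` in `L²`: they are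
uniform limits of the rows of the truncated kernels. -/
theorem continuous_toLp_kernelRow (hab : a ≤ b) (hα : 1 / 2 < α)
    (hKc : ContinuousOn (Function.uncurry K) (triangle a b))
    (hKb : ∀ p ∈ triangle a b, ‖K p.1 p.2‖ ≤ C * (p.1 - p.2) ^ (α - 1)) :
    Continuous fun t : Icc a b => (memLp_kernelRow hab hα hKc hKb t.2.2).toLp := by
  refine continuous_of_uniform_approx_of_continuous fun u hu => ?_
  obtain ⟨ε, hε, hεu⟩ := Metric.mem_uniformity_dist.1 hu
  -- Cutting off at scale `δ / 2` changes a row only where `0 < t - s ≤ δ`.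
  obtain ⟨δ, hδ, hδε⟩ := exists_eLpNorm_cutPow_le hα
    (show 0 < ε / (|C| + 1) by positivity)
  refine ⟨_, continuous_toLp_truncated hab hα hKc hKb (half_pos hδ), fun t => hεu ?_⟩
  rw [dist_eq_norm, ← MemLp.toLp_sub, Lp.norm_toLp]
  refine ENNReal.toReal_lt_of_lt_ofReal (lt_of_le_of_lt
    (eLpNorm_le_cutPow (α := α) (C := |C|) (δ := δ) (t := t) Measure.restrict_le_self ?_) ?_)
  · refine (ae_restrict_iff' measurableSet_Icc).2 (ae_of_all _ fun s hs => ?_)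
    have h1 := norm_kernelRow_le hKb t.2.2 hs.1
    simp only [Pi.sub_apply]
    rcases le_or_gt ((t : ℝ) - s) δ with h | h
    · have e : kernelRow K t s - cutoff (δ / 2) (t - s) • kernelRow K t s =
          (1 - cutoff (δ / 2) (t - s)) • kernelRow K t s := by rw [sub_smul, one_smul]
      have h2 : cutPow α (b - a) (t - s) ≤ cutPow α δ (t - s) := by
        rw [cutPow, cutPow]
        by_cases h0 : (t : ℝ) - s ∈ Ioc 0 (b - a)
        · rw [indicator_of_mem h0, indicator_of_mem (show (t : ℝ) - s ∈ Ioc 0 δ from ⟨h0.1, h⟩)]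
        · rw [indicator_of_notMem h0]
          exact cutPow_nonneg _ _ _
      rw [e, norm_smul, Real.norm_of_nonneg (sub_nonneg.2 (cutoff_le_one _ _))]
      refine (mul_le_of_le_one_left (norm_nonneg _)
        (by linarith [cutoff_nonneg (δ / 2) (t - s)])).trans (h1.trans ?_)
      exact mul_le_mul (le_abs_self C) h2 (cutPow_nonneg _ _ _) (abs_nonneg _)
    · rw [cutoff_eq_one (half_pos hδ) (by linarith), one_smul, sub_self, norm_zero]
      exact mul_nonneg (abs_nonneg _) (cutPow_nonneg _ _ _)
  · refine lt_of_le_of_lt (mul_le_mul_right hδε _) ?_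
    rw [← ENNReal.ofReal_mul (abs_nonneg _), ENNReal.ofReal_lt_ofReal_iff hε, mul_div_assoc',
      div_lt_iff₀ (by positivity)]
    nlinarith [abs_nonneg C]

end Singular

section Volterra

variable {X : Type*} [NormedAddCommGroup X] [NormedSpace ℝ X] [CompleteSpace X]
  {G : Type*} [NormedAddCommGroup G] [NormedSpace ℝ G]

/-- A weakly singular Volterra operator with a norm continuous kernel of compact operators is a
compact operator from `L²([a, b], X)` to `C([a, b], X)`. -/
theorem exists_volterra_operator {a b α C : ℝ} (hab : a ≤ b) (hα : 1 / 2 < α)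
    {B : G →L[ℝ] X →L[ℝ] X} (hB : ∀ c, IsCompactOperator (B c)) {K : ℝ → ℝ → G}
    (hKc : ContinuousOn (Function.uncurry K) (triangle a b))
    (hKb : ∀ p ∈ triangle a b, ‖K p.1 p.2‖ ≤ C * (p.1 - p.2) ^ (α - 1)) :
    (∀ f : Lp X 2 (volume.restrict (Icc a b)), ∀ t ∈ Icc a b,
      IntervalIntegrable (fun s => B (K t s) (f s)) volume a t) ∧
    ∃ Λ : Lp X 2 (volume.restrict (Icc a b)) →L[ℝ] C(Icc a b, X),
      (∀ f (t : Icc a b), Λ f t = ∫ s in a..t, B (K t s) (f s)) ∧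
      IsCompactOperator Λ := by
  set μ := volume.restrict (Icc a b) with hμ
  have hrestrict : ∀ t ∈ Icc a b, μ.restrict (Iio t) = volume.restrict (Ico a t) := by
    intro t ht
    rw [hμ, Measure.restrict_restrict measurableSet_Iio]
    congr 1
    ext s
    exact ⟨fun h => ⟨h.2.1, h.1⟩, fun h => ⟨h.2, h.1, h.2.le.trans ht.2⟩⟩
  have happly : ∀ (f : Lp X 2 μ) (t : ℝ), (fun s => B (kernelRow K t s) (f s)) =
      (Iio t).indicator fun s => B (K t s) (f s) := by
    intro f t
    funext s
    by_cases h : s ∈ Iio t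
    · rw [kernelRow, indicator_of_mem h, indicator_of_mem h]
    · rw [kernelRow, indicator_of_notMem h, indicator_of_notMem h]; simp
  have hrow : ∀ t ∈ Icc a b, MemLp (kernelRow K t) 2 μ := fun t ht =>
    memLp_kernelRow hab hα hKc hKb ht.2
  refine ⟨fun f t ht => ?_, ?_⟩
  · have h1 : Integrable (fun s => B (kernelRow K t s) (f s)) μ :=
      memLp_one_iff_integrable.1
        (B.memLp_of_bilin 1 (hrow t ht) (Lp.memLp f))
    rw [happly, integrable_indicator_iff measurableSet_Iio, IntegrableOn, hrestrict t ht] at h1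
    rw [intervalIntegrable_iff_integrableOn_Ico_of_le ht.1]
    exact h1
  · let Ψ : C(Icc a b, Lp X 2 μ →L[ℝ] X) :=
      ⟨fun t => kernelIntegral B μ (hrow t t.2).toLp,
        (kernelIntegral B μ).continuous.comp (continuous_toLp_kernelRow hab hα hKc hKb)⟩
    refine ⟨familyOperator Ψ, fun f t => ?_, isCompactOperator_familyOperator Ψ fun t =>
      isCompactOperator_kernelIntegral hB μ _⟩
    have e : familyOperator Ψ f t = ∫ s, B (kernelRow K t s) (f s) ∂μ := by
      rw [familyOperator_apply]
      change kernelIntegral B μ (hrow t t.2).toLp f = _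
      rw [kernelIntegral_apply]
      refine integral_congr_ae ?_
      filter_upwards [(hrow t t.2).coeFn_toLp] with s hs
      rw [hs]
    rw [e, happly, integral_indicator measurableSet_Iio, hrestrict t t.2,
      intervalIntegral.integral_of_le t.2.1, integral_Ico_eq_integral_Ioc]

end Volterra

/-! ### The time change, the weighted space and the kernel -/

namespace TimeChange

variable {a b : ℝ} (ψ : TimeChange a b)

theorem continuousOn_deriv (hab : a < b) : ContinuousOn ψ.deriv (Icc a b) :=
  ψ.contDiffOn.continuousOn_derivWithin (uniqueDiffOn_Icc hab) le_rfl

theorem deriv_pos {t : ℝ} (ht : t ∈ Icc a b) : 0 < ψ.deriv t :=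
  lt_of_le_of_ne (ψ.strictMonoOn.monotoneOn.derivWithin_nonneg) (ψ.deriv_ne_zero t ht).symm

theorem exists_mul_sub_le (hab : a < b) :
    ∃ m > 0, ∀ s ∈ Icc a b, ∀ t ∈ Icc a b, s ≤ t → m * (t - s) ≤ ψ t - ψ s := by
  obtain ⟨s₀, hs₀, hmin⟩ := isCompact_Icc.exists_isMinOn (nonempty_Icc.2 hab.le)
    (ψ.continuousOn_deriv hab)
  refine ⟨ψ.deriv s₀, ψ.deriv_pos hs₀, fun s hs t ht hst => ?_⟩
  refine (convex_Icc a b).mul_sub_le_image_sub_of_le_deriv ψ.contDiffOn.continuousOn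
    ((ψ.contDiffOn.differentiableOn one_ne_zero).mono interior_subset) (fun x hx => ?_) s hs t ht hst
  rw [← derivWithin_of_mem_nhds (mem_interior_iff_mem_nhds.1 hx)]
  exact hmin (interior_subset hx)

theorem exists_deriv_le (hab : a < b) : ∃ M, ∀ s ∈ Icc a b, ψ.deriv s ≤ M := by
  obtain ⟨M, hM⟩ := isCompact_Icc.bddAbove_image (ψ.continuousOn_deriv hab)
  exact ⟨M, fun s hs => hM ⟨s, hs, rfl⟩⟩

theorem sub_nonneg {s t : ℝ} (hs : s ∈ Icc a b) (ht : t ∈ Icc a b) (hst : s ≤ t) :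
    0 ≤ ψ t - ψ s :=
  _root_.sub_nonneg.2 (ψ.strictMonoOn.monotoneOn hs ht hst)

end TimeChange

section

variable {a b : ℝ} {X : Type*} [NormedAddCommGroup X] [NormedSpace ℝ X]

/-- For `r ≥ 0` the inclusion `C([a, b], X) → C^{r;ψ}([a, b], X)`. The weight `(ψ(t) - ψ(a))^r` is
continuous up to `t = a`, also for `r = 0`, where `0 ^ 0 = 1`. -/
def WeightedC.ofContinuous (hab : a ≤ b) (ψ : TimeChange a b) (r : ℝ) (hr : 0 ≤ r) :
    C(Icc a b, X) →L[ℝ] WeightedC r ψ X :=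
  have ha : a ∈ Icc a b := ⟨le_rfl, hab⟩
  LinearMap.mkContinuous
    { toFun := fun q =>
        ⟨fun t => q ⟨t, Ioc_subset_Icc_self t.2⟩,
          q.continuous.comp (continuous_subtype_val.subtype_mk _),
          ⟨fun t => (ψ t - ψ a) ^ r • q t,
            ((Real.continuous_rpow_const hr).comp
              ((continuousOn_iff_continuous_domRestrict.1 ψ.contDiffOn.continuousOn).sub
                continuous_const)).smul q.continuous⟩, fun t => rfl⟩
      map_add' := fun p q => rfl
      map_smul' := fun c q => rfl }
    ((ψ b - ψ a) ^ r) fun q => by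
      have hb := Real.rpow_nonneg (ψ.sub_nonneg ha ⟨hab, le_rfl⟩ hab) r
      refine Real.iSup_le (fun t => ?_) (mul_nonneg hb (norm_nonneg _))
      have ht : (t : ℝ) ∈ Icc a b := Ioc_subset_Icc_self t.2
      have h0 := ψ.sub_nonneg ha ht ht.1
      rw [norm_smul, Real.norm_of_nonneg (Real.rpow_nonneg h0 r)]
      refine mul_le_mul (Real.rpow_le_rpow h0 ?_ hr) (q.norm_coe_le_norm _) (norm_nonneg _) hb
      exact sub_le_sub_right (ψ.strictMonoOn.monotoneOn ht ⟨hab, le_rfl⟩ ht.2) _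

theorem WeightedC.ofContinuous_apply (hab : a ≤ b) (ψ : TimeChange a b) (r : ℝ) (hr : 0 ≤ r)
    (q : C(Icc a b, X)) (t : Ioc a b) :
    WeightedC.ofContinuous hab ψ r hr q t = q ⟨t, Ioc_subset_Icc_self t.2⟩ := rfl

/-- The normed space of compact operators on `X`, as a type of its own, so that functions with
values in it can be taken in `Lp`. -/
def CompactOp (X : Type*) [NormedAddCommGroup X] [NormedSpace ℝ X] : Type _ :=
  compactOperator (RingHom.id ℝ) X X

instance : NormedAddCommGroup (CompactOp X) :=
  inferInstanceAs (NormedAddCommGroup (compactOperator (RingHom.id ℝ) X X))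

instance : NormedSpace ℝ (CompactOp X) :=
  inferInstanceAs (NormedSpace ℝ (compactOperator (RingHom.id ℝ) X X))

/-- The inclusion of the compact operators into the bounded operators. -/
def CompactOp.inclusion : CompactOp X →ₗᵢ[ℝ] X →L[ℝ] X :=
  (compactOperator (RingHom.id ℝ) X X).subtypeₗᵢ

theorem CompactOp.isCompactOperator (A : CompactOp X) :
    IsCompactOperator (CompactOp.inclusion A) := A.2

end

/-- The kernel `ψ'(s) (ψ(t) - ψ(s))^(α-1) P(ψ(t) - ψ(s))` as a continuous, weakly singular kernel
with values in the compact operators. Off the triangle `s < t` its values do not matter. -/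
theorem exists_hilfer_kernel {X : Type*} [NormedAddCommGroup X] [NormedSpace ℝ X]
    {P : ℝ → X →L[ℝ] X}
    (hPc : ∀ t : ℝ, 0 < t → IsCompactOperator (P t))
    (hPb : ∀ R : ℝ, ∃ C : ℝ, ∀ t ∈ Ioc 0 R, ‖P t‖ ≤ C) (hP : ContinuousOn P (Ioi 0))
    {a b : ℝ} (hab : a < b) (ψ : TimeChange a b) {α : ℝ} (hα1 : α ≤ 1) :
    ∃ C : ℝ, ∃ K : ℝ → ℝ → CompactOp X, ContinuousOn (Function.uncurry K) (triangle a b) ∧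
      (∀ p ∈ triangle a b, ‖K p.1 p.2‖ ≤ C * (p.1 - p.2) ^ (α - 1)) ∧
      ∀ p ∈ triangle a b, CompactOp.inclusion (K p.1 p.2) =
        ψ.deriv p.2 • (ψ p.1 - ψ p.2) ^ (α - 1) • P (ψ p.1 - ψ p.2) := by
  classical
  let Pc : ℝ → CompactOp X := fun t => if h : 0 < t then ⟨P t, hPc t h⟩ else 0
  have hPcP : ∀ t, 0 < t → CompactOp.inclusion (Pc t) = P t := fun t ht => by
    rw [show Pc t = ⟨P t, hPc t ht⟩ from dif_pos ht]; rfl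
  have hPcc : ContinuousOn Pc (Ioi 0) := by
    rw [CompactOp.inclusion.isometry.isEmbedding.isInducing.continuousOn_iff]
    exact hP.congr fun t ht => hPcP t ht
  obtain ⟨m, hm, hmψ⟩ := ψ.exists_mul_sub_le hab
  obtain ⟨M, hM⟩ := ψ.exists_deriv_le hab
  obtain ⟨C, hC⟩ := hPb (ψ b - ψ a)
  have hmem : ∀ p ∈ triangle a b, p.1 ∈ Icc a b ∧ p.2 ∈ Icc a b := fun p hp =>
    ⟨⟨hp.1.trans hp.2.1.le, hp.2.2⟩, ⟨hp.1, hp.2.1.le.trans hp.2.2⟩⟩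
  have hpos : ∀ p ∈ triangle a b, 0 < ψ p.1 - ψ p.2 := fun p hp =>
    sub_pos.2 (ψ.strictMonoOn (hmem p hp).2 (hmem p hp).1 hp.2.1)
  have hsub : ContinuousOn (fun p : ℝ × ℝ => ψ p.1 - ψ p.2) (triangle a b) :=
    (ψ.contDiffOn.continuousOn.comp continuousOn_fst fun p hp => (hmem p hp).1).sub
      (ψ.contDiffOn.continuousOn.comp continuousOn_snd fun p hp => (hmem p hp).2)
  refine ⟨M * (m ^ (α - 1) * C),
    fun t s => ψ.deriv s • (ψ t - ψ s) ^ (α - 1) • Pc (ψ t - ψ s), ?_, ?_, ?_⟩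
  · refine ((ψ.continuousOn_deriv hab).comp continuousOn_snd fun p hp => (hmem p hp).2).smul
      ((hsub.rpow_const fun p hp => Or.inl (hpos p hp).ne').smul (hPcc.comp hsub hpos))
  · intro p hp
    obtain ⟨h1, h2⟩ := hmem p hp
    have hd := ψ.deriv_pos h2
    have hp0 : 0 < p.1 - p.2 := sub_pos.2 hp.2.1
    have hP' : ‖Pc (ψ p.1 - ψ p.2)‖ ≤ C := by
      rw [← CompactOp.inclusion.norm_map, hPcP _ (hpos p hp)]
      refine hC _ ⟨hpos p hp, ?_⟩
      have h3 := ψ.sub_nonneg h1 (right_mem_Icc.2 hab.le) h1.2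
      have h4 := ψ.sub_nonneg (left_mem_Icc.2 hab.le) h2 h2.1
      linarith
    have hrp : (ψ p.1 - ψ p.2) ^ (α - 1) ≤ m ^ (α - 1) * (p.1 - p.2) ^ (α - 1) := by
      rw [← Real.mul_rpow hm.le hp0.le]
      exact Real.rpow_le_rpow_of_nonpos (by positivity) (hmψ _ h2 _ h1 hp.2.1.le) (by linarith)
    have hr0 := Real.rpow_nonneg (hpos p hp).le (α - 1)
    rw [norm_smul, norm_smul, Real.norm_of_nonneg hd.le, Real.norm_of_nonneg hr0]
    have hC0 := (norm_nonneg _).trans hP'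
    have hM0 := hd.le.trans (hM _ h2)
    calc _ ≤ M * ((m ^ (α - 1) * (p.1 - p.2) ^ (α - 1)) * C) := by
          gcongr
          exact hM _ h2
      _ = _ := by ring
  · intro p hp
    rw [map_smul, map_smul, hPcP _ (hpos p hp)]

end PsiHilfer

end

theorem lemma5p8 {X : Type*} [NormedAddCommGroup X] [NormedSpace ℝ X] [CompleteSpace X]
    (T : ℝ → X →L[ℝ] X) (hT : PsiHilfer.IsC0Semigroup T)
    (a b : ℝ) (hab : a < b) (ψ : PsiHilfer.TimeChange a b)
    (α β γ : ℝ) (hα : 1 / 2 < α) (hα1 : α ≤ 1) (hβ : 0 ≤ β) (hβ1 : β ≤ 1)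
    (hγ : γ = α + β * (1 - α))
    (hP : ∀ t : ℝ, 0 < t → IsCompactOperator (PsiHilfer.opP α T t)) :
    (∀ f : Lp X 2 (volume.restrict (Icc a b)), ∀ t ∈ Ioc a b,
      IntervalIntegrable (fun s => ψ.deriv s • PsiHilfer.opK α T (ψ t - ψ s) (f s)) volume a t) ∧
    ∃ Λ : Lp X 2 (volume.restrict (Icc a b)) →L[ℝ] PsiHilfer.WeightedC (1 - γ) ψ X,
      (∀ (f : Lp X 2 (volume.restrict (Icc a b))) (t : Ioc a b),
        Λ f t = ∫ s in a..t, ψ.deriv s • PsiHilfer.opK α T (ψ t - ψ s) (f s)) ∧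
      IsCompactOperator Λ := by
  obtain ⟨P, hPP, hPb, hPc⟩ := hT.exists_opP_family (by linarith) hα1 hP
  obtain ⟨C, K, hKc, hKb, hK⟩ := PsiHilfer.exists_hilfer_kernel
    (fun t ht => by rw [hPP t ht]; exact hP t ht) hPb hPc hab ψ hα1
  obtain ⟨hint, Λ, hΛ, hΛc⟩ := PsiHilfer.exists_volterra_operator hab.le hα
    (B := PsiHilfer.CompactOp.inclusion.toContinuousLinearMap)
    PsiHilfer.CompactOp.isCompactOperator hKc hKb
  -- The two forms of the integrand may differ at `s = t`, a null set.
  have hcongr : ∀ (f : Lp X 2 (volume.restrict (Icc a b))), ∀ t ∈ Icc a b, ∀ s ∈ Ioo a t,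
      PsiHilfer.CompactOp.inclusion.toContinuousLinearMap (K t s) (f s) =
        ψ.deriv s • PsiHilfer.opK α T (ψ t - ψ s) (f s) := by
    intro f t ht s hs
    have hs' : s ∈ Icc a b := ⟨hs.1.le, hs.2.le.trans ht.2⟩
    have h := hK (t, s) ⟨hs.1.le, hs.2, ht.2⟩
    change PsiHilfer.CompactOp.inclusion (K t s) (f s) = _
    rw [h, PsiHilfer.opK, ← hPP _ (sub_pos.2 (ψ.strictMonoOn hs' ht hs.2))]
    rfl
  have hr : 0 ≤ 1 - γ := by
    have : 1 - γ = (1 - α) * (1 - β) := by rw [hγ]; ring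
    rw [this]
    exact mul_nonneg (sub_nonneg.2 hα1) (sub_nonneg.2 hβ1)
  refine ⟨fun f t ht => ?_, (PsiHilfer.WeightedC.ofContinuous hab.le ψ (1 - γ) hr).comp Λ,
    fun f t => ?_, hΛc.clm_comp (PsiHilfer.WeightedC.ofContinuous hab.le ψ (1 - γ) hr)⟩
  · have h := hint f t (Ioc_subset_Icc_self ht)
    rw [intervalIntegrable_iff_integrableOn_Ioo_of_le ht.1.le] at h ⊢
    exact h.congr_fun (hcongr f t (Ioc_subset_Icc_self ht)) measurableSet_Ioo
  · rw [ContinuousLinearMap.comp_apply, PsiHilfer.WeightedC.ofContinuous_apply, hΛ,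
      intervalIntegral.integral_of_le t.2.1.le, intervalIntegral.integral_of_le t.2.1.le,
      integral_Ioc_eq_integral_Ioo, integral_Ioc_eq_integral_Ioo]
    exact setIntegral_congr_fun measurableSet_Ioo (hcongr f t (Ioc_subset_Icc_self t.2))
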